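/- For a real number $k$ and $T>0$ let $$M_k(T)=\int_0^T \left|\zeta\left(\tfrac12+it\right)\right|^{2k}\,dt,$$ where $\zeta$ is the Riemann zeta function. For every real number $k>1$ there is a real number $T_0=T_0(k)$ such that for all real $T\ge T_0$ $$M_k(T)\ \ge\ e^{-30k^4}\,T\,(\log T)^{k^2}.$$ -/

import Mathlib

/-- The `2k`-th moment of the Riemann zeta function on the critical line,
`M_k(T) = ∫_0^T |ζ(1/2 + it)|^{2k} dt`, for real `k`. -/
noncomputable def zetaMoment (k T : ℝ) : ℝ :=
  ∫ t in (0 : ℝ)..T, ‖riemannZeta (1 / 2 + (t : ℂ) * Complex.I)‖ ^ (2 * k)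

open Filter Topology ComplexConjugate

/-! Put q = 2k/(2k-1). Hölder's inequality gives |∫ ζ·B·conj C|^(2k) ≤ ∫|ζ|^(2k) ·
(∫|B·C|^q)^(2k-1), where C imitates ζ^k and B imitates ζ^(k-1). If the left integral is at least
TΛ/2 and the last one at most 2TΛ, where Λ is the mean square of C, then the moment is at least
2^(-4k)·TΛ (`mul_prod_pairing_le_integral`).

The primes up to e^L, with L = log T / (50000k^4), are cut into blocks on which log p varies by a
factor at most 4. On block i let Y_i = 1 + (1/s_i) ∑ p^(-s), so that Y_i^(s_i) imitates the part of
ζ coming from that block. With r_i = ⌊k s_i⌋ take W = ∏ Y_i^(s_i), B = ∏ Y_i^(r_i - s_i) and C = W·B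
= ∏ Y_i^(r_i). The powers s_i grow like 2^i while the logarithms of the primes shrink like 4^(-i),
so these products have length at most T^(1/40).

Lower bound for the twisted integral (`le_norm_integral_zeta_mul`): ζ is replaced by a partial sum
of its Dirichlet series, whose coefficients 1 dominate those of W (`coeff_prod_linear_pow_le_one`).
All coefficients being nonnegative, the diagonal contribution is at least that of W·B against C,
which is Λ.

Upper bound (`integral_prod_rpow_le`): |B·C|^q is a product over blocks of powers θ_i ≤ 1 of
|Y_i^(r_i)|^2. Bernoulli's inequality bounds each power by an affine function of |Y_i^(r_i)|^2. The
product then expands into mean squares of short polynomials, which factor over the blocks by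
coprimality.

Size of Λ (`exp_le_prod_pairing`): the squarefree terms of Y_i^(r_i) already give nearly ∏(1 +
k^2/p) over the block, and Mertens' theorem makes the product over all blocks at least a constant
depending on k times (log T)^(k^2). -/

/-! ### Euler–Maclaurin approximation of ζ to the right of the imaginary axis. -/

/-- `(s - 1)` times the error of the trapezoid rule for `x ↦ x ^ (-s)` on `[n, n + 1]`. -/
noncomputable def trapezoidError (n : ℕ) (s : ℂ) : ℂ :=
  (s - 1) * (((n : ℂ) ^ (-s) + ((n + 1 : ℕ) : ℂ) ^ (-s)) / 2) - (n : ℂ) ^ (1 - s)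
    + ((n + 1 : ℕ) : ℂ) ^ (1 - s)

lemma hasDerivAt_natCast_add_cpow {n : ℕ} (hn : 0 < n) (c : ℂ) {u : ℝ} (hu : 0 ≤ u) :
    HasDerivAt (fun u : ℝ => ((n : ℂ) + u) ^ c) (c * ((n : ℂ) + u) ^ (c - 1)) u := by
  have hn' : (0 : ℝ) < n := by exact_mod_cast hn
  have h2 : ((n : ℂ) + u) ∈ Complex.slitPlane := by
    left; simp; linarith
  have h1 : HasDerivAt (fun z : ℂ => (n : ℂ) + z) 1 u := (hasDerivAt_id _).const_add _
  simpa using (h1.cpow_const (c := c) h2).comp_ofReal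

/-- Let the right endpoint n + 1 vary as n + u. The error `φ u` vanishes together with its
derivative at u = 0, and its second derivative is a single explicit term, so the mean value
inequality is applied twice. -/
lemma norm_trapezoidError_le {n : ℕ} (hn : 0 < n) {s : ℂ} (hs : -2 ≤ s.re) :
    ‖trapezoidError n s‖ ≤ ‖s - 1‖ * ‖s‖ * ‖s + 1‖ / 2 * (n : ℝ) ^ (-s.re - 2) := by
  have hn' : (0 : ℝ) < n := by exact_mod_cast hn
  set K : ℝ := ‖s - 1‖ * ‖s‖ * ‖s + 1‖ / 2 * (n : ℝ) ^ (-s.re - 2) with hK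
  have hK0 : 0 ≤ K := by positivity
  let a : ℂ := (n : ℂ)
  let φ : ℝ → ℂ := fun u => (s - 1) * ((u : ℂ) / 2 * (a ^ (-s) + (a + u) ^ (-s))) - a ^ (1 - s)
    + (a + u) ^ (1 - s)
  let φ' : ℝ → ℂ := fun u => (s - 1) * ((a ^ (-s) - (a + u) ^ (-s)) / 2
      - (u : ℂ) / 2 * s * (a + u) ^ (-s - 1))
  let φ'' : ℝ → ℂ := fun u => (s - 1) * s * (s + 1) * ((u : ℂ) / 2) * (a + u) ^ (-s - 2)
  have hid : ∀ u : ℝ, HasDerivAt (fun u : ℝ => (u : ℂ) / 2) (1 / 2) u := fun u =>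
    (Complex.ofRealCLM.hasDerivAt (x := u)).div_const 2
  have d1 : ∀ u : ℝ, 0 ≤ u → HasDerivAt φ (φ' u) u := by
    intro u hu
    have h0 := hasDerivAt_natCast_add_cpow hn (-s) hu
    have h1 := hasDerivAt_natCast_add_cpow hn (1 - s) hu
    have h2 := ((((hid u).mul (h0.const_add (a ^ (-s)))).const_mul (s - 1)).sub_const
      (a ^ (1 - s))).add h1
    refine h2.congr_deriv ?_
    have : (1 - s - 1 : ℂ) = -s := by ring
    simp only [φ', a, this]
    ring
  have d2 : ∀ u : ℝ, 0 ≤ u → HasDerivAt φ' (φ'' u) u := by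
    intro u hu
    have h0 := hasDerivAt_natCast_add_cpow hn (-s) hu
    have h1 := hasDerivAt_natCast_add_cpow hn (-s - 1) hu
    have h2 := (((h0.const_sub (a ^ (-s))).div_const 2).sub
      (((hid u).mul_const s).mul h1)).const_mul (s - 1)
    refine h2.congr_deriv ?_
    have : (-s - 1 - 1 : ℂ) = -s - 2 := by ring
    simp only [φ'', a, this]
    ring
  have hb : ∀ u : ℝ, 0 ≤ u → u ≤ 1 → ‖φ'' u‖ ≤ K := by
    intro u hu hu1
    have e1 : a + u = ((n + u : ℝ) : ℂ) := by simp [a]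
    have hpos : (0 : ℝ) < n + u := by linarith
    have e2 : ‖(a + u) ^ (-s - 2)‖ = (n + u : ℝ) ^ (-s.re - 2) := by
      rw [e1, Complex.norm_cpow_eq_rpow_re_of_pos hpos]; simp
    have e3 : (n + u : ℝ) ^ (-s.re - 2) ≤ (n : ℝ) ^ (-s.re - 2) :=
      Real.rpow_le_rpow_of_nonpos hn' (by linarith) (by linarith)
    have e4 : ‖(u : ℂ) / 2‖ ≤ 1 / 2 := by
      rw [norm_div, Complex.norm_real, Real.norm_of_nonneg hu]; simp; linarith
    simp only [φ'', norm_mul, e2]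
    calc ‖s - 1‖ * ‖s‖ * ‖s + 1‖ * ‖(u : ℂ) / 2‖ * (n + u : ℝ) ^ (-s.re - 2)
        ≤ ‖s - 1‖ * ‖s‖ * ‖s + 1‖ * (1 / 2) * (n : ℝ) ^ (-s.re - 2) := by gcongr
      _ = K := by rw [hK]; ring
  have c1 : ∀ u ∈ Set.Icc (0 : ℝ) 1, ‖φ' u‖ ≤ K := by
    intro u hu
    have := norm_image_sub_le_of_norm_deriv_le_segment' (f := φ') (f' := φ'') (a := 0) (b := 1)
      (C := K) (fun x hx => (d2 x hx.1).hasDerivWithinAt) (fun x hx => hb x hx.1 hx.2.le) u hu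
    have h0 : φ' 0 = 0 := by simp [φ']
    rw [h0, sub_zero, sub_zero] at this
    exact this.trans (mul_le_of_le_one_right hK0 hu.2)
  have := norm_image_sub_le_of_norm_deriv_le_segment_01' (f := φ) (f' := φ')
      (C := K) (fun x hx => (d1 x hx.1).hasDerivWithinAt) (fun x hx => c1 x ⟨hx.1, hx.2.le⟩)
  have h0 : φ 0 = 0 := by simp [φ]
  have h1 : φ 1 = trapezoidError n s := by
    simp only [φ, trapezoidError, a]; push_cast; ring
  rwa [h0, sub_zero, h1] at this

lemma hasSum_telescope_inv {N : ℕ} (hN : 0 < N) :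
    HasSum (fun i : ℕ => 1 / ((N + i : ℕ) : ℝ) - 1 / ((N + (i + 1) : ℕ) : ℝ)) (1 / N) := by
  rw [hasSum_iff_tendsto_nat_of_nonneg]
  · simp_rw [Finset.sum_range_sub' (fun i : ℕ => 1 / ((N + i : ℕ) : ℝ))]
    have : Tendsto (fun n : ℕ => 1 / ((N + n : ℕ) : ℝ)) atTop (𝓝 0) := by
      have := tendsto_one_div_atTop_nhds_zero_nat (𝕜 := ℝ)
      exact this.comp (tendsto_add_atTop_nat N |>.congr fun n => add_comm _ _)
    simpa using tendsto_const_nhds.sub this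
  · intro i
    have : (0 : ℝ) < ((N + i : ℕ) : ℝ) := by positivity
    rw [sub_nonneg]
    apply one_div_le_one_div_of_le this
    push_cast; linarith

/-- With m = N + i, the factor m^(-x) is at most N^(-x), and m^(-2) ≤ 2/(m(m+1)), which telescopes.
-/
lemma rpow_neg_add_two_le {N : ℕ} (hN : 0 < N) {x : ℝ} (hx : 0 ≤ x) (i : ℕ) :
    ((N + i : ℕ) : ℝ) ^ (-x - 2) ≤ 2 * (N : ℝ) ^ (-x) *
      (1 / ((N + i : ℕ) : ℝ) - 1 / ((N + (i + 1) : ℕ) : ℝ)) := by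
  have hN' : (1 : ℝ) ≤ N := by exact_mod_cast hN
  have hm : (1 : ℝ) ≤ ((N + i : ℕ) : ℝ) := by push_cast; linarith [(Nat.cast_nonneg i : (0 : ℝ) ≤ i)]
  set m : ℝ := ((N + i : ℕ) : ℝ) with hmdef
  have e : ((N + (i + 1) : ℕ) : ℝ) = m + 1 := by rw [hmdef]; push_cast; ring
  have hNm : (N : ℝ) ≤ m := by rw [hmdef]; push_cast; linarith [(Nat.cast_nonneg i : (0 : ℝ) ≤ i)]
  rw [e, sub_eq_add_neg, Real.rpow_add (by linarith)]
  have h1 : m ^ (-x) ≤ (N : ℝ) ^ (-x) :=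
    Real.rpow_le_rpow_of_nonpos (by linarith) hNm (by linarith)
  have h2 : m ^ (-2 : ℝ) ≤ 2 * (1 / m - 1 / (m + 1)) := by
    rw [Real.rpow_neg (by linarith), Real.rpow_two]
    have : 2 * (1 / m - 1 / (m + 1)) = 2 / (m * (m + 1)) := by field_simp; ring
    rw [this, ← one_div, div_le_div_iff₀ (by positivity) (by positivity)]
    nlinarith
  calc m ^ (-x) * m ^ (-2 : ℝ) ≤ (N : ℝ) ^ (-x) * (2 * (1 / m - 1 / (m + 1))) := by gcongr
    _ = _ := by ring

lemma norm_trapezoidError_add_le {N : ℕ} (hN : 0 < N) {s : ℂ} (hs : 0 ≤ s.re) (i : ℕ) :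
    ‖trapezoidError (N + i) s‖ ≤ ‖s - 1‖ * ‖s‖ * ‖s + 1‖ * (N : ℝ) ^ (-s.re) *
      (1 / ((N + i : ℕ) : ℝ) - 1 / ((N + (i + 1) : ℕ) : ℝ)) := by
  refine (norm_trapezoidError_le (by omega) (by linarith)).trans ?_
  calc _ ≤ ‖s - 1‖ * ‖s‖ * ‖s + 1‖ / 2 * (2 * (N : ℝ) ^ (-s.re) *
      (1 / ((N + i : ℕ) : ℝ) - 1 / ((N + (i + 1) : ℕ) : ℝ))) := by
        gcongr; exact rpow_neg_add_two_le hN hs i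
    _ = _ := by ring

lemma norm_tsum_trapezoidError_le {N : ℕ} (hN : 0 < N) {s : ℂ} (hs : 0 ≤ s.re) :
    ‖∑' i : ℕ, trapezoidError (N + i) s‖ ≤ ‖s - 1‖ * ‖s‖ * ‖s + 1‖ * (N : ℝ) ^ (-s.re) / N := by
  have := tsum_of_norm_bounded ((hasSum_telescope_inv hN).mul_left
    (‖s - 1‖ * ‖s‖ * ‖s + 1‖ * (N : ℝ) ^ (-s.re))) (norm_trapezoidError_add_le hN hs)
  rwa [mul_one_div] at this

lemma differentiable_trapezoidError {n : ℕ} (hn : 0 < n) : Differentiable ℂ (trapezoidError n) := by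
  have h1 : (n : ℂ) ≠ 0 := by exact_mod_cast hn.ne'
  have h2 : ((n + 1 : ℕ) : ℂ) ≠ 0 := by exact_mod_cast (Nat.succ_ne_zero n)
  have k1 : Differentiable ℂ fun s : ℂ => (n : ℂ) ^ (-s) :=
    differentiable_id.neg.const_cpow (Or.inl h1)
  have k2 : Differentiable ℂ fun s : ℂ => ((n + 1 : ℕ) : ℂ) ^ (-s) :=
    differentiable_id.neg.const_cpow (Or.inl h2)
  have k3 : Differentiable ℂ fun s : ℂ => (n : ℂ) ^ (1 - s) :=
    (differentiable_id.const_sub 1).const_cpow (Or.inl h1)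
  have k4 : Differentiable ℂ fun s : ℂ => ((n + 1 : ℕ) : ℂ) ^ (1 - s) :=
    (differentiable_id.const_sub 1).const_cpow (Or.inl h2)
  exact (((differentiable_id.sub_const 1).mul ((k1.add k2).div_const 2)).sub k3).add k4

lemma differentiableOn_tsum_trapezoidError {N : ℕ} (hN : 0 < N) :
    DifferentiableOn ℂ (fun s => ∑' i : ℕ, trapezoidError (N + i) s) {s : ℂ | 0 < s.re} := by
  intro s₀ hs₀
  set B : ℝ := ‖s₀‖ + 1
  have hopen : IsOpen ({s : ℂ | 0 < s.re} ∩ Metric.ball 0 B) :=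
    (isOpen_lt continuous_const Complex.continuous_re).inter Metric.isOpen_ball
  have hmem : s₀ ∈ {s : ℂ | 0 < s.re} ∩ Metric.ball 0 B := ⟨hs₀, by simp [B]⟩
  have hB : 0 < B := by positivity
  have : DifferentiableOn ℂ (fun s => ∑' i : ℕ, trapezoidError (N + i) s)
      ({s : ℂ | 0 < s.re} ∩ Metric.ball 0 B) := by
    refine Complex.differentiableOn_tsum_of_summable_norm
      ((hasSum_telescope_inv hN).summable.mul_left ((B + 1) * B * (B + 1)))
      (fun i => (differentiable_trapezoidError (by omega)).differentiableOn) hopen ?_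
    intro i s hs
    refine (norm_trapezoidError_add_le hN hs.1.le i).trans ?_
    have hsB : ‖s‖ ≤ B := by simpa using (Metric.mem_ball.1 hs.2).le
    have h1 : ‖s - 1‖ ≤ B + 1 := (norm_sub_le _ _).trans (by simpa using hsB)
    have h2 : ‖s + 1‖ ≤ B + 1 := (norm_add_le _ _).trans (by simpa using hsB)
    have h3 : (N : ℝ) ^ (-s.re) ≤ 1 :=
      Real.rpow_le_one_of_one_le_of_nonpos (by exact_mod_cast hN) (by linarith [hs.1.out])
    have h4 : 0 ≤ 1 / ((N + i : ℕ) : ℝ) - 1 / ((N + (i + 1) : ℕ) : ℝ) := by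
      rw [sub_nonneg]
      apply one_div_le_one_div_of_le (by positivity)
      push_cast; linarith
    apply mul_le_mul_of_nonneg_right _ h4
    calc ‖s - 1‖ * ‖s‖ * ‖s + 1‖ * (N : ℝ) ^ (-s.re) ≤ (B + 1) * B * (B + 1) * 1 := by gcongr
      _ = _ := mul_one _
  exact (this.differentiableAt (hopen.mem_nhds hmem)).differentiableWithinAt

lemma sum_trapezoidError (N m : ℕ) (s : ℂ) :
    ∑ i ∈ Finset.range m, trapezoidError (N + i) s =
      (s - 1) * (∑ n ∈ Finset.range (N + m), (n : ℂ) ^ (-s) - ∑ n ∈ Finset.range N, (n : ℂ) ^ (-s)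
        - (N : ℂ) ^ (-s) / 2 + ((N + m : ℕ) : ℂ) ^ (-s) / 2)
        - (N : ℂ) ^ (1 - s) + ((N + m : ℕ) : ℂ) ^ (1 - s) := by
  induction m with
  | zero => simp
  | succ m ih =>
    rw [Finset.sum_range_succ, ih, ← add_assoc, Finset.sum_range_succ, trapezoidError]
    ring

lemma tendsto_natCast_cpow_zero {c : ℂ} (hc : c.re < 0) (N : ℕ) :
    Tendsto (fun m : ℕ => ((N + m : ℕ) : ℂ) ^ c) atTop (𝓝 0) := by
  rw [tendsto_zero_iff_norm_tendsto_zero]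
  have h1 : Tendsto (fun m : ℕ => ((N + m : ℕ) : ℝ) ^ c.re) atTop (𝓝 0) := by
    have := (tendsto_rpow_neg_atTop (y := -c.re) (by linarith)).comp tendsto_natCast_atTop_atTop
    rw [neg_neg] at this
    exact this.comp (tendsto_add_atTop_nat N |>.congr fun n => add_comm _ _)
  refine h1.congr' ?_
  filter_upwards [eventually_gt_atTop 0] with m hm
  rw [Complex.norm_natCast_cpow_of_pos (by omega)]

lemma mul_riemannZeta_eq_of_one_lt {N : ℕ} {s : ℂ} (hN : 0 < N) (hs : 1 < s.re) :
    (s - 1) * riemannZeta s = (s - 1) * (∑ n ∈ Finset.range N, (n : ℂ) ^ (-s) + (N : ℂ) ^ (-s) / 2)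
      + (N : ℂ) ^ (1 - s) + ∑' i : ℕ, trapezoidError (N + i) s := by
  have hsum : Summable fun i : ℕ => trapezoidError (N + i) s :=
    Summable.of_norm_bounded ((hasSum_telescope_inv hN).mul_left
      (‖s - 1‖ * ‖s‖ * ‖s + 1‖ * (N : ℝ) ^ (-s.re))).summable
      (norm_trapezoidError_add_le hN (by linarith))
  have h1 := hsum.hasSum.tendsto_sum_nat
  have h2 : Tendsto (fun m : ℕ => ∑ n ∈ Finset.range (N + m), (n : ℂ) ^ (-s)) atTop
      (𝓝 (riemannZeta s)) := by
    have hz : HasSum (fun n : ℕ => (n : ℂ) ^ (-s)) (riemannZeta s) := by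
      rw [zeta_eq_tsum_one_div_nat_cpow hs]
      have := (Complex.summable_one_div_nat_cpow.2 hs).hasSum
      simpa [Complex.cpow_neg] using this
    exact hz.tendsto_sum_nat.comp (tendsto_add_atTop_nat N |>.congr fun n => add_comm _ _)
  have h3 := tendsto_natCast_cpow_zero (c := -s) (by simp; linarith) N
  have h4 := tendsto_natCast_cpow_zero (c := 1 - s) (by simp; linarith) N
  have h5 := (((((h2.sub_const (∑ n ∈ Finset.range N, (n : ℂ) ^ (-s))).sub_const
    ((N : ℂ) ^ (-s) / 2)).add (h3.div_const 2)).const_mul (s - 1)).sub_const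
    ((N : ℂ) ^ (1 - s))).add h4
  have h6 := tendsto_nhds_unique h1 (h5.congr fun m => (sum_trapezoidError N m s).symm)
  rw [h6]; ring

/-- Analytic continuation from Re s > 1: the right side is holomorphic for Re s > 0 because the
error series converges locally uniformly there, and the left side is the entire function
`riemannZeta₁`. -/
lemma mul_riemannZeta_eq {N : ℕ} {s : ℂ} (hN : 0 < N) (hs : 0 < s.re) (hs1 : s ≠ 1) :
    (s - 1) * riemannZeta s = (s - 1) * (∑ n ∈ Finset.range N, (n : ℂ) ^ (-s) + (N : ℂ) ^ (-s) / 2)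
      + (N : ℂ) ^ (1 - s) + ∑' i : ℕ, trapezoidError (N + i) s := by
  set U : Set ℂ := {s : ℂ | 0 < s.re}
  have hU : IsOpen U := isOpen_lt continuous_const Complex.continuous_re
  have hpow : ∀ n : ℕ, DifferentiableOn ℂ (fun s : ℂ => (n : ℂ) ^ (-s)) U := by
    intro n z hz
    -- The index n = 0 occurs in the sum. Its exponent is nonzero throughout `U`, so the term is
    -- identically 0 there.
    have : (n : ℂ) ≠ 0 ∨ -z ≠ 0 := by
      right; intro h; rw [neg_eq_zero] at h; simp [h, U] at hz
    exact (differentiableAt_id.neg.const_cpow this).differentiableWithinAt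
  have hN0 : (N : ℂ) ≠ 0 := by exact_mod_cast hN.ne'
  have hg : DifferentiableOn ℂ (fun s : ℂ =>
      (s - 1) * (∑ n ∈ Finset.range N, (n : ℂ) ^ (-s) + (N : ℂ) ^ (-s) / 2)
      + (N : ℂ) ^ (1 - s) + ∑' i : ℕ, trapezoidError (N + i) s) U := by
    refine DifferentiableOn.add (DifferentiableOn.add (DifferentiableOn.mul
      (differentiable_id.sub_const 1).differentiableOn (DifferentiableOn.add
        (DifferentiableOn.fun_sum fun n _ => hpow n) ((hpow N).div_const 2))) ?_)
      (differentiableOn_tsum_trapezoidError hN)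
    exact ((differentiable_id.const_sub 1).const_cpow (Or.inl hN0)).differentiableOn
  have heq : Set.EqOn riemannZeta₁ (fun s : ℂ =>
      (s - 1) * (∑ n ∈ Finset.range N, (n : ℂ) ^ (-s) + (N : ℂ) ^ (-s) / 2)
      + (N : ℂ) ^ (1 - s) + ∑' i : ℕ, trapezoidError (N + i) s) U := by
    refine AnalyticOnNhd.eqOn_of_preconnected_of_eventuallyEq (z₀ := 2)
      (differentiable_riemannZeta₁.differentiableOn.analyticOnNhd hU) (hg.analyticOnNhd hU)
      (convex_halfSpace_re_gt 0).isPreconnected (by simp [U]) ?_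
    have : {s : ℂ | 1 < s.re} ∈ 𝓝 (2 : ℂ) :=
      (isOpen_lt continuous_const Complex.continuous_re).mem_nhds (by simp)
    filter_upwards [this] with z hz
    have hz1 : z ≠ 1 := by rintro rfl; simp at hz
    rw [← mul_riemannZeta_eq_of_one_lt hN hz, riemannZeta_eq_inv_sub_mul hz1]
    field_simp [sub_ne_zero.2 hz1]
  have := heq (show s ∈ U from hs)
  refine Eq.trans ?_ this
  rw [riemannZeta_eq_inv_sub_mul hs1]
  field_simp [sub_ne_zero.2 hs1]

/-- Approximation of `ζ` on the critical line by a long partial sum of its Dirichlet series. -/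
lemma norm_riemannZeta_sub_sum_le {N : ℕ} (hN : 0 < N) {t : ℝ} (ht : 1 ≤ t) :
    ‖riemannZeta (1 / 2 + (t : ℂ) * Complex.I) -
        ∑ n ∈ Finset.range N, (n : ℂ) ^ (-(1 / 2 + (t : ℂ) * Complex.I))‖ ≤
      (N : ℝ) ^ (-(1 / 2) : ℝ) + (N : ℝ) ^ (1 / 2 : ℝ) / t
        + 6 * t ^ 2 * (N : ℝ) ^ (-(1 / 2) : ℝ) / N := by
  set s : ℂ := 1 / 2 + (t : ℂ) * Complex.I with hs
  have hre : s.re = 1 / 2 := by simp [hs]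
  have him : s.im = t := by simp [hs]
  have hs1 : s ≠ 1 := by intro h; rw [h] at him; simp at him; linarith
  have hs1' : s - 1 ≠ 0 := sub_ne_zero.2 hs1
  have hN' : (0 : ℝ) < N := by exact_mod_cast hN
  have key := mul_riemannZeta_eq hN (s := s) (by rw [hre]; norm_num) hs1
  have e : riemannZeta s - ∑ n ∈ Finset.range N, (n : ℂ) ^ (-s) =
      (N : ℂ) ^ (-s) / 2 + (N : ℂ) ^ (1 - s) / (s - 1)
        + (∑' i : ℕ, trapezoidError (N + i) s) / (s - 1) := by
    field_simp
    linear_combination 2 * key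
  rw [e]
  have n1 : ‖(N : ℂ) ^ (-s) / 2‖ ≤ (N : ℝ) ^ (-(1 / 2) : ℝ) := by
    rw [norm_div, Complex.norm_natCast_cpow_of_pos hN]
    simp only [Complex.neg_re, hre, Complex.norm_ofNat]
    linarith [Real.rpow_pos_of_pos hN' (-(1 / 2) : ℝ)]
  have ht1 : t ≤ ‖s - 1‖ := by
    have := Complex.abs_im_le_norm (s - 1)
    rw [Complex.sub_im, him] at this
    simp at this
    exact (le_abs_self t).trans this
  have n2 : ‖(N : ℂ) ^ (1 - s) / (s - 1)‖ ≤ (N : ℝ) ^ (1 / 2 : ℝ) / t := by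
    rw [norm_div, Complex.norm_natCast_cpow_of_pos hN]
    have : (1 - s).re = 1 / 2 := by simp [hre]; norm_num
    rw [this]
    gcongr
  have hsn : ‖s‖ ≤ 2 * t := by
    refine (norm_add_le _ _).trans ?_
    simp [abs_of_pos (show 0 < t by linarith)]
    linarith
  have hsn1 : ‖s + 1‖ ≤ 3 * t := by
    refine (norm_add_le _ _).trans ?_
    simp; linarith
  have n3 : ‖(∑' i : ℕ, trapezoidError (N + i) s) / (s - 1)‖ ≤
      6 * t ^ 2 * (N : ℝ) ^ (-(1 / 2) : ℝ) / N := by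
    rw [norm_div, div_le_iff₀ (norm_pos_iff.2 hs1')]
    refine (norm_tsum_trapezoidError_le hN (by rw [hre]; norm_num)).trans ?_
    rw [hre]
    calc ‖s - 1‖ * ‖s‖ * ‖s + 1‖ * (N : ℝ) ^ (-(1 / 2) : ℝ) / N
        ≤ ‖s - 1‖ * (2 * t) * (3 * t) * (N : ℝ) ^ (-(1 / 2) : ℝ) / N := by gcongr
      _ = _ := by ring
  exact (norm_add_le _ _).trans (add_le_add ((norm_add_le _ _).trans (add_le_add n1 n2)) n3)

/-! ### Dirichlet polynomials on the critical line and their mean values. -/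

/-- Dirichlet polynomials with real coefficients, as the monoid algebra of `(ℕ, *)`. -/
abbrev DirPoly : Type := MonoidAlgebra ℝ ℕ

namespace DirPoly

/-- The completely multiplicative function `n ↦ n ^ (-(1/2 + it))`. -/
noncomputable def critChar (t : ℝ) : ℕ →* ℂ where
  toFun n := (n : ℂ) ^ (-(1 / 2 + (t : ℂ) * Complex.I))
  map_one' := by simp
  map_mul' m n := by
    rw [Nat.cast_mul, Complex.natCast_mul_natCast_cpow]

/-- The completely multiplicative function `n ↦ n ^ (-1/2)`. -/
noncomputable def absChar : ℕ →* ℝ where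
  toFun n := (n : ℝ) ^ (-(1 / 2) : ℝ)
  map_one' := by simp
  map_mul' m n := by
    rw [Nat.cast_mul, Real.mul_rpow (by positivity) (by positivity)]

/-- The value of a Dirichlet polynomial at `1/2 + it`. -/
noncomputable def eval (t : ℝ) : DirPoly →ₐ[ℝ] ℂ := MonoidAlgebra.lift ℝ ℂ ℕ (critChar t)

/-- The value of a Dirichlet polynomial at `1/2`. -/
noncomputable def total : DirPoly →ₐ[ℝ] ℝ := MonoidAlgebra.lift ℝ ℝ ℕ absChar

/-- The mean value of `F(1/2 + it)` times the conjugate of `G(1/2 + it)`. -/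
noncomputable def pairing (F G : DirPoly) : ℝ := F.coeff.sum fun n a => a * G.coeff n / n

/-- All coefficients are nonnegative. -/
def Nonneg (F : DirPoly) : Prop := ∀ n, 0 ≤ F.coeff n

lemma eval_eq_sum (t : ℝ) (F : DirPoly) :
    eval t F = ∑ n ∈ F.coeff.support, (F.coeff n : ℂ) * critChar t n := by
  simp [eval, MonoidAlgebra.lift_apply, Finsupp.sum]

lemma total_eq_sum (F : DirPoly) :
    total F = ∑ n ∈ F.coeff.support, F.coeff n * absChar n := by
  simp [total, MonoidAlgebra.lift_apply, Finsupp.sum]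

/-- The index 0 belongs to the monoid ℕ. It evaluates to 0 here and in `absChar`, and division by 0
removes it from `pairing`, so it never contributes. -/
lemma critChar_zero (t : ℝ) : critChar t 0 = 0 := by
  have : -(1 / 2 + (t : ℂ) * Complex.I) ≠ 0 := by
    intro h
    have := congrArg Complex.re h
    simp at this
  simp only [critChar, MonoidHom.coe_mk, OneHom.coe_mk, Nat.cast_zero]
  exact Complex.zero_cpow this

lemma absChar_zero : absChar 0 = 0 := by
  simp only [absChar, MonoidHom.coe_mk, OneHom.coe_mk, Nat.cast_zero]
  exact Real.zero_rpow (by norm_num)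

lemma absChar_nonneg (n : ℕ) : 0 ≤ absChar n := by
  simp only [absChar, MonoidHom.coe_mk, OneHom.coe_mk]; positivity

lemma absChar_mul_self (n : ℕ) : absChar n * absChar n = 1 / n := by
  rcases Nat.eq_zero_or_pos n with rfl | hn
  · simp [absChar_zero]
  · have : (0 : ℝ) < n := by exact_mod_cast hn
    simp only [absChar, MonoidHom.coe_mk, OneHom.coe_mk]
    rw [← Real.rpow_add this, one_div (n : ℝ), ← Real.rpow_neg_one (n : ℝ)]
    norm_num

lemma absChar_le_one (n : ℕ) : absChar n ≤ 1 := by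
  rcases Nat.eq_zero_or_pos n with rfl | hn
  · simp [absChar_zero]
  · simp only [absChar, MonoidHom.coe_mk, OneHom.coe_mk]
    exact Real.rpow_le_one_of_one_le_of_nonpos (by exact_mod_cast hn) (by norm_num)

lemma critChar_eq {n : ℕ} (hn : 0 < n) (t : ℝ) :
    critChar t n = absChar n * Complex.exp (-(Real.log n * t : ℝ) * Complex.I) := by
  have h0 : (n : ℂ) ≠ 0 := by exact_mod_cast hn.ne'
  simp only [critChar, absChar, MonoidHom.coe_mk, OneHom.coe_mk]
  rw [neg_add, Complex.cpow_add _ _ h0, Complex.ofReal_cpow (by positivity)]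
  congr 1
  · push_cast; norm_num
  · rw [Complex.cpow_def_of_ne_zero h0, Complex.natCast_log.symm]
    congr 1; push_cast; ring

lemma norm_critChar (n : ℕ) (t : ℝ) : ‖critChar t n‖ = absChar n := by
  rcases Nat.eq_zero_or_pos n with rfl | hn
  · simp [critChar_zero, absChar_zero]
  · have e : (-(Real.log n * t : ℝ) * Complex.I : ℂ) = ((-(Real.log n * t) : ℝ) : ℂ) * Complex.I := by
      push_cast; ring
    rw [critChar_eq hn, e, norm_mul, Complex.norm_exp_ofReal_mul_I, mul_one, Complex.norm_real,
      Real.norm_of_nonneg (absChar_nonneg n)]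

lemma continuous_critChar (n : ℕ) : Continuous fun t => critChar t n := by
  rcases Nat.eq_zero_or_pos n with rfl | hn
  · simp only [critChar_zero]; exact continuous_const
  · simp only [critChar_eq hn]
    fun_prop

lemma continuous_eval (F : DirPoly) : Continuous fun t => eval t F := by
  simp only [eval_eq_sum]
  exact continuous_finsetSum _ fun n _ => continuous_const.mul (continuous_critChar n)

lemma critChar_mul_conj {m n : ℕ} (hm : 0 < m) (hn : 0 < n) (t : ℝ) :
    critChar t m * conj (critChar t n) = (absChar m * absChar n : ℝ) *
      Complex.exp (((Real.log n - Real.log m : ℝ) : ℂ) * Complex.I * t) := by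
  rw [critChar_eq hm, critChar_eq hn, map_mul, ← Complex.exp_conj]
  simp only [map_mul, Complex.conj_ofReal, map_neg, Complex.conj_I]
  rw [mul_mul_mul_comm, ← Complex.exp_add]
  push_cast
  congr 2; ring

/-- From log x ≥ 1 - 1/x. Only n needs an upper bound: if m > n then 1 - n/m ≥ 1/(n+1), however
large m is. Hence in the mean value estimate only one of the two polynomials has to be short, and a
partial sum of ζ longer than the interval is allowed as the other. -/
lemma one_div_le_abs_log_sub {m n N : ℕ} (hm : 0 < m) (hn : 0 < n) (hmn : m ≠ n) (hN : n ≤ N) :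
    1 / (2 * N : ℝ) ≤ |Real.log n - Real.log m| := by
  have hm' : (0 : ℝ) < m := by exact_mod_cast hm
  have hn' : (0 : ℝ) < n := by exact_mod_cast hn
  have hn1 : (1 : ℝ) ≤ n := by exact_mod_cast hn
  have hNn : (n : ℝ) ≤ N := by exact_mod_cast hN
  rcases lt_or_gt_of_ne hmn with h | h
  · have h1 : (m : ℝ) + 1 ≤ n := by exact_mod_cast h
    have h2 := Real.log_le_sub_one_of_pos (div_pos hm' hn')
    rw [Real.log_div hm'.ne' hn'.ne'] at h2
    refine le_trans ?_ (le_abs_self _)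
    have h3 : 1 / (2 * N : ℝ) ≤ 1 - m / n := by
      rw [one_sub_div hn'.ne', div_le_div_iff₀ (by linarith) hn']
      nlinarith
    linarith
  · have h1 : (n : ℝ) + 1 ≤ m := by exact_mod_cast h
    have h2 := Real.log_le_sub_one_of_pos (div_pos hn' hm')
    rw [Real.log_div hn'.ne' hm'.ne'] at h2
    refine le_trans ?_ (neg_le_abs _)
    have h3 : 1 / (2 * N : ℝ) ≤ 1 - n / m := by
      rw [one_sub_div hm'.ne', div_le_div_iff₀ (by linarith) hm']
      nlinarith
    linarith

lemma norm_integral_critChar_sub_le {m n N : ℕ} (hN : n ≤ N) (a b : ℝ) :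
    ‖(∫ t in a..b, critChar t m * conj (critChar t n)) -
        ((if m = n then (b - a) / n else 0 : ℝ) : ℂ)‖ ≤ 4 * N * (absChar m * absChar n) := by
  have hnn : 0 ≤ 4 * (N : ℝ) * (absChar m * absChar n) :=
    mul_nonneg (by positivity) (mul_nonneg (absChar_nonneg _) (absChar_nonneg _))
  rcases Nat.eq_zero_or_pos m with rfl | hm
  · simp only [critChar_zero, zero_mul, intervalIntegral.integral_zero]
    split_ifs with h
    · subst h; simpa using hnn
    · simpa using hnn
  rcases Nat.eq_zero_or_pos n with rfl | hn
  · simp only [critChar_zero, map_zero, mul_zero, intervalIntegral.integral_zero]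
    split_ifs with h
    · simpa using hnn
    · simpa using hnn
  simp only [critChar_mul_conj hm hn, intervalIntegral.integral_const_mul]
  split_ifs with h
  · subst h
    rw [absChar_mul_self] at *
    simp only [sub_self, Complex.ofReal_zero, zero_mul, Complex.exp_zero]
    rw [intervalIntegral.integral_const]
    refine le_of_eq_of_le ?_ hnn
    rw [norm_eq_zero, Complex.real_smul]
    push_cast; ring
  · set c : ℝ := Real.log n - Real.log m with hc
    have hcl := one_div_le_abs_log_sub hm hn h hN
    have hN0 : (0 : ℝ) < N := by exact_mod_cast hn.trans_le hN
    have hc0 : 0 < |c| := lt_of_lt_of_le (by positivity) hcl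
    have hcI : (c : ℂ) * Complex.I ≠ 0 :=
      mul_ne_zero (by exact_mod_cast abs_pos.1 hc0) Complex.I_ne_zero
    rw [integral_exp_mul_complex hcI, Complex.ofReal_zero, sub_zero, norm_mul, norm_div,
      Complex.norm_real, Real.norm_of_nonneg (mul_nonneg (absChar_nonneg _) (absChar_nonneg _))]
    have e1 : ‖(c : ℂ) * Complex.I‖ = |c| := by simp
    have e2 : ‖Complex.exp ((c : ℂ) * Complex.I * b) - Complex.exp ((c : ℂ) * Complex.I * a)‖ ≤ 2 := by
      refine (norm_sub_le _ _).trans ?_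
      have : ∀ x : ℝ, ‖Complex.exp ((c : ℂ) * Complex.I * x)‖ = 1 := fun x => by
        have : (c : ℂ) * Complex.I * x = ((c * x : ℝ) : ℂ) * Complex.I := by push_cast; ring
        rw [this, Complex.norm_exp_ofReal_mul_I]
      rw [this, this]; norm_num
    rw [e1, mul_comm (4 * (N : ℝ))]
    gcongr
    · exact mul_nonneg (absChar_nonneg _) (absChar_nonneg _)
    rw [div_le_iff₀ hc0]
    refine e2.trans ?_
    calc (2 : ℝ) = 4 * N * (1 / (2 * N)) := by field_simp; norm_num
      _ ≤ 4 * N * |c| := by gcongr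

/-- Mean values of products of Dirichlet polynomials over an interval, up to the contribution
of the off-diagonal terms. -/
lemma norm_integral_eval_mul_conj_sub_le {F G : DirPoly} (hF : Nonneg F) (hG : Nonneg G) {N : ℕ}
    (hN : ∀ n ∈ G.coeff.support, n ≤ N) (a b : ℝ) :
    ‖(∫ t in a..b, eval t F * conj (eval t G)) - (((b - a) * pairing F G : ℝ) : ℂ)‖ ≤
      4 * N * total F * total G := by
  have e1 : (∫ t in a..b, eval t F * conj (eval t G)) =
      ∑ m ∈ F.coeff.support, ∑ n ∈ G.coeff.support, ((F.coeff m * G.coeff n : ℝ) : ℂ) *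
        ∫ t in a..b, critChar t m * conj (critChar t n) := by
    have : ∀ t, eval t F * conj (eval t G) = ∑ m ∈ F.coeff.support, ∑ n ∈ G.coeff.support,
        ((F.coeff m * G.coeff n : ℝ) : ℂ) * (critChar t m * conj (critChar t n)) := by
      intro t
      rw [eval_eq_sum, eval_eq_sum, map_sum, Finset.sum_mul_sum]
      refine Finset.sum_congr rfl fun m _ => Finset.sum_congr rfl fun n _ => ?_
      rw [map_mul, Complex.conj_ofReal]; push_cast; ring
    have hcont : ∀ m n : ℕ, Continuous fun t => critChar t m * conj (critChar t n) := fun m n =>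
      (continuous_critChar m).mul (Complex.continuous_conj.comp (continuous_critChar n))
    simp only [this]
    rw [intervalIntegral.integral_finsetSum]
    · refine Finset.sum_congr rfl fun m _ => ?_
      rw [intervalIntegral.integral_finsetSum]
      · refine Finset.sum_congr rfl fun n _ => ?_
        rw [intervalIntegral.integral_const_mul]
      · intro n _
        exact (continuous_const.mul (hcont m n)).intervalIntegrable _ _
    · intro m _
      exact (continuous_finsetSum _ fun n _ =>
        continuous_const.mul (hcont m n)).intervalIntegrable _ _
  have e2 : (((b - a) * pairing F G : ℝ) : ℂ) =
      ∑ m ∈ F.coeff.support, ∑ n ∈ G.coeff.support, ((F.coeff m * G.coeff n : ℝ) : ℂ) *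
        ((if m = n then (b - a) / n else 0 : ℝ) : ℂ) := by
    rw [pairing, Finsupp.sum, Finset.mul_sum]
    push_cast
    refine Finset.sum_congr rfl fun m _ => ?_
    simp only [apply_ite Complex.ofReal, mul_ite, Complex.ofReal_zero, mul_zero]
    rw [Finset.sum_ite_eq]
    split_ifs with h
    · push_cast; ring
    · rw [Finsupp.notMem_support_iff.1 h]; simp
  have e3 : 4 * N * total F * total G = ∑ m ∈ F.coeff.support, ∑ n ∈ G.coeff.support,
      F.coeff m * G.coeff n * (4 * N * (absChar m * absChar n)) := by
    rw [total_eq_sum, total_eq_sum, mul_assoc, Finset.sum_mul_sum, Finset.mul_sum]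
    refine Finset.sum_congr rfl fun m _ => ?_
    rw [Finset.mul_sum]
    refine Finset.sum_congr rfl fun n _ => by ring
  rw [e1, e2, e3, ← Finset.sum_sub_distrib]
  refine norm_sum_le_of_le _ fun m _ => ?_
  rw [← Finset.sum_sub_distrib]
  refine norm_sum_le_of_le _ fun n hn => ?_
  rw [← mul_sub, norm_mul, Complex.norm_real, Real.norm_of_nonneg (mul_nonneg (hF m) (hG n))]
  exact mul_le_mul_of_nonneg_left (norm_integral_critChar_sub_le (hN n hn) a b)
    (mul_nonneg (hF m) (hG n))

/-! ### Nonnegative coefficients and coefficientwise comparison. -/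

lemma norm_eval_le_total {F : DirPoly} (hF : Nonneg F) (t : ℝ) : ‖eval t F‖ ≤ total F := by
  rw [eval_eq_sum, total_eq_sum]
  refine norm_sum_le_of_le _ fun n _ => ?_
  rw [norm_mul, norm_critChar, Complex.norm_real, Real.norm_of_nonneg (hF n)]

lemma total_nonneg {F : DirPoly} (hF : Nonneg F) : 0 ≤ total F := by
  rw [total_eq_sum]
  exact Finset.sum_nonneg fun n _ => mul_nonneg (hF n) (absChar_nonneg n)

lemma Nonneg.add {F G : DirPoly} (hF : Nonneg F) (hG : Nonneg G) : Nonneg (F + G) := fun n => by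
  rw [MonoidAlgebra.coeff_add]; exact add_nonneg (hF n) (hG n)

lemma Nonneg.mul {F G : DirPoly} (hF : Nonneg F) (hG : Nonneg G) : Nonneg (F * G) := fun n => by
  rw [MonoidAlgebra.coeff_mul]
  refine Finset.sum_nonneg fun i _ => Finset.sum_nonneg fun j _ => ?_
  dsimp only
  split_ifs
  · exact mul_nonneg (hF i) (hG j)
  · exact le_rfl

lemma nonneg_single (n : ℕ) {a : ℝ} (ha : 0 ≤ a) : Nonneg (MonoidAlgebra.single n a) := fun m => by
  rw [MonoidAlgebra.coeff_single, Finsupp.single_apply]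
  split_ifs
  · exact ha
  · exact le_rfl

lemma nonneg_one : Nonneg 1 := nonneg_single 1 zero_le_one

lemma nonneg_zero : Nonneg 0 := fun n => by simp

lemma Nonneg.pow {F : DirPoly} (hF : Nonneg F) (n : ℕ) : Nonneg (F ^ n) := by
  induction n with
  | zero => rw [pow_zero]; exact nonneg_one
  | succ n ih => rw [pow_succ]; exact ih.mul hF

lemma nonneg_sum {ι : Type*} (s : Finset ι) (F : ι → DirPoly) (h : ∀ i ∈ s, Nonneg (F i)) :
    Nonneg (∑ i ∈ s, F i) :=
  Finset.sum_induction F Nonneg (fun _ _ => Nonneg.add) nonneg_zero h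

lemma nonneg_prod {ι : Type*} (s : Finset ι) (F : ι → DirPoly) (h : ∀ i ∈ s, Nonneg (F i)) :
    Nonneg (∏ i ∈ s, F i) :=
  Finset.prod_induction F Nonneg (fun _ _ => Nonneg.mul) nonneg_one h

lemma nonneg_sub_iff {F G : DirPoly} : Nonneg (G - F) ↔ ∀ n, F.coeff n ≤ G.coeff n := by
  simp [Nonneg, MonoidAlgebra.coeff_sub]

/-- Products of nonnegative Dirichlet polynomials are monotone in the coefficients. -/
lemma nonneg_prod_sub_prod {ι : Type*} (s : Finset ι) (F G : ι → DirPoly)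
    (hF : ∀ i ∈ s, Nonneg (F i)) (hFG : ∀ i ∈ s, Nonneg (G i - F i)) :
    Nonneg (∏ i ∈ s, G i - ∏ i ∈ s, F i) := by
  classical
  induction s using Finset.induction_on with
  | empty => simpa using nonneg_zero
  | insert a s ha ih =>
    rw [Finset.prod_insert ha, Finset.prod_insert ha]
    have h1 := ih (fun i hi => hF i (Finset.mem_insert_of_mem hi))
      (fun i hi => hFG i (Finset.mem_insert_of_mem hi))
    have h2 := hFG a (Finset.mem_insert_self _ _)
    have h3 := hF a (Finset.mem_insert_self _ _)
    have h4 := nonneg_prod s F fun i hi => hF i (Finset.mem_insert_of_mem hi)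
    have h5 : Nonneg (∏ i ∈ s, G i) := by
      simpa using h1.add h4
    have : G a * ∏ i ∈ s, G i - F a * ∏ i ∈ s, F i =
        (G a - F a) * ∏ i ∈ s, G i + F a * (∏ i ∈ s, G i - ∏ i ∈ s, F i) := by ring
    rw [this]
    exact (h2.mul h5).add (h3.mul h1)

lemma pairing_mono_left {F F' G : DirPoly} (hG : Nonneg G) (h : Nonneg (F' - F)) :
    pairing F G ≤ pairing F' G := by
  classical
  have key : ∀ F : DirPoly, ∀ s : Finset ℕ, F.coeff.support ⊆ s →
      pairing F G = ∑ n ∈ s, F.coeff n * G.coeff n / n := fun F s hs =>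
    Finsupp.sum_of_support_subset _ hs _ (by simp)
  rw [key F (F.coeff.support ∪ F'.coeff.support) Finset.subset_union_left,
    key F' (F.coeff.support ∪ F'.coeff.support) Finset.subset_union_right]
  refine Finset.sum_le_sum fun n _ => ?_
  have := nonneg_sub_iff.1 h n
  have := hG n
  gcongr

end DirPoly

/-! ### Supports, and factorization over disjoint sets of primes. -/

namespace DirPoly

/-- All `n` in the support of `F` are nonzero with every prime factor in `S`. -/
def SupportedOn (S : Set ℕ) (F : DirPoly) : Prop :=
  ∀ n, F.coeff n ≠ 0 → n ≠ 0 ∧ ∀ p, p.Prime → p ∣ n → p ∈ S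

/-- All `n` in the support of `F` are at most `N`. -/
def SupportLe (N : ℝ) (F : DirPoly) : Prop := ∀ n, F.coeff n ≠ 0 → (n : ℝ) ≤ N

lemma exists_of_coeff_mul_ne_zero {F G : DirPoly} {n : ℕ} (h : (F * G).coeff n ≠ 0) :
    ∃ a b, F.coeff a ≠ 0 ∧ G.coeff b ≠ 0 ∧ a * b = n := by
  rw [MonoidAlgebra.coeff_mul] at h
  obtain ⟨a, ha, h⟩ := Finset.exists_ne_zero_of_sum_ne_zero h
  obtain ⟨b, hb, h⟩ := Finset.exists_ne_zero_of_sum_ne_zero h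
  refine ⟨a, b, Finsupp.mem_support_iff.1 ha, Finsupp.mem_support_iff.1 hb, ?_⟩
  by_contra hab
  simp [hab] at h

lemma coeff_one_ne_zero {n : ℕ} (h : (1 : DirPoly).coeff n ≠ 0) : n = 1 := by
  by_contra hn
  rw [MonoidAlgebra.one_def, MonoidAlgebra.coeff_single, Finsupp.single_apply,
    if_neg (Ne.symm hn)] at h
  exact h rfl

lemma coeff_single_ne_zero {m n : ℕ} {c : ℝ} (h : (MonoidAlgebra.single m c).coeff n ≠ 0) :
    n = m := by
  by_contra hn
  rw [MonoidAlgebra.coeff_single, Finsupp.single_apply, if_neg (Ne.symm hn)] at h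
  exact h rfl

lemma exists_of_coeff_sum_ne_zero {ι : Type*} {s : Finset ι} {F : ι → DirPoly} {n : ℕ}
    (h : (∑ i ∈ s, F i).coeff n ≠ 0) : ∃ i ∈ s, (F i).coeff n ≠ 0 := by
  rw [MonoidAlgebra.coeff_sum, Finsupp.finsetSum_apply] at h
  exact Finset.exists_ne_zero_of_sum_ne_zero h

lemma supportedOn_one (S : Set ℕ) : SupportedOn S 1 := fun n hn => by
  rw [coeff_one_ne_zero hn]
  exact ⟨one_ne_zero, fun p hp h => absurd (Nat.dvd_one.1 h) hp.ne_one⟩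

lemma SupportedOn.mono {S S' : Set ℕ} {F : DirPoly} (h : SupportedOn S F) (hS : S ⊆ S') :
    SupportedOn S' F := fun n hn => ⟨(h n hn).1, fun p hp hpn => hS ((h n hn).2 p hp hpn)⟩

lemma SupportedOn.mul {S : Set ℕ} {F G : DirPoly} (hF : SupportedOn S F) (hG : SupportedOn S G) :
    SupportedOn S (F * G) := fun n hn => by
  obtain ⟨a, b, ha, hb, rfl⟩ := exists_of_coeff_mul_ne_zero hn
  refine ⟨mul_ne_zero (hF a ha).1 (hG b hb).1, fun p hp h => ?_⟩
  rcases (hp.dvd_mul).1 h with h | h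
  · exact (hF a ha).2 p hp h
  · exact (hG b hb).2 p hp h

lemma SupportedOn.prod {ι : Type*} {S : Set ℕ} (s : Finset ι) (F : ι → DirPoly)
    (h : ∀ i ∈ s, SupportedOn S (F i)) : SupportedOn S (∏ i ∈ s, F i) :=
  Finset.prod_induction F (SupportedOn S) (fun _ _ => SupportedOn.mul) (supportedOn_one S) h

lemma SupportedOn.pow {S : Set ℕ} {F : DirPoly} (hF : SupportedOn S F) (n : ℕ) :
    SupportedOn S (F ^ n) := by
  simpa using SupportedOn.prod (Finset.range n) (fun _ => F) fun _ _ => hF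

lemma SupportLe.mul {M N : ℝ} {F G : DirPoly} (hM : 0 ≤ M) (hF : SupportLe M F)
    (hG : SupportLe N G) : SupportLe (M * N) (F * G) := fun n hn => by
  obtain ⟨a, b, ha, hb, rfl⟩ := exists_of_coeff_mul_ne_zero hn
  rw [Nat.cast_mul]
  exact mul_le_mul (hF a ha) (hG b hb) (by positivity) hM

lemma SupportLe.prod {ι : Type*} (s : Finset ι) (F : ι → DirPoly) (N : ι → ℝ)
    (hN : ∀ i ∈ s, 0 ≤ N i) (h : ∀ i ∈ s, SupportLe (N i) (F i)) :
    SupportLe (∏ i ∈ s, N i) (∏ i ∈ s, F i) := by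
  classical
  induction s using Finset.induction_on with
  | empty => intro n hn; simp only [Finset.prod_empty] at hn ⊢; simp [coeff_one_ne_zero hn]
  | insert a s ha ih =>
    rw [Finset.prod_insert ha, Finset.prod_insert ha]
    exact (h a (Finset.mem_insert_self _ _)).mul (hN a (Finset.mem_insert_self _ _))
      (ih (fun i hi => hN i (Finset.mem_insert_of_mem hi))
        fun i hi => h i (Finset.mem_insert_of_mem hi))

lemma SupportLe.pow {N : ℝ} {F : DirPoly} (hN : 0 ≤ N) (hF : SupportLe N F) (n : ℕ) :
    SupportLe (N ^ n) (F ^ n) := by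
  simpa using SupportLe.prod (Finset.range n) (fun _ => F) (fun _ => N) (fun _ _ => hN)
    fun _ _ => hF

lemma coprime_of_supportedOn {S S' : Set ℕ} (hS : Disjoint S S') {F G : DirPoly}
    (hF : SupportedOn S F) (hG : SupportedOn S' G) {a b : ℕ} (ha : F.coeff a ≠ 0)
    (hb : G.coeff b ≠ 0) : Nat.Coprime a b :=
  Nat.coprime_of_dvd fun p hp h1 h2 =>
    Set.disjoint_left.1 hS ((hF a ha).2 p hp h1) ((hG b hb).2 p hp h2)

/-- Since a is coprime to b' and a' is coprime to b, a and a' divide each other. -/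
lemma mul_inj_of_supportedOn {S S' : Set ℕ} (hS : Disjoint S S') {F G : DirPoly}
    (hF : SupportedOn S F) (hG : SupportedOn S' G) {a b a' b' : ℕ} (ha : F.coeff a ≠ 0)
    (hb : G.coeff b ≠ 0) (ha' : F.coeff a' ≠ 0) (hb' : G.coeff b' ≠ 0) (h : a * b = a' * b') :
    a = a' ∧ b = b' := by
  have e : a = a' := Nat.dvd_antisymm
    ((coprime_of_supportedOn hS hF hG ha hb').dvd_of_dvd_mul_right (h ▸ dvd_mul_right a b))
    ((coprime_of_supportedOn hS hF hG ha' hb).dvd_of_dvd_mul_right (h ▸ dvd_mul_right a' b'))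
  refine ⟨e, ?_⟩
  subst e
  exact Nat.eq_of_mul_eq_mul_left (Nat.pos_of_ne_zero (hF a ha).1) h

lemma coeff_mul_of_supportedOn {S S' : Set ℕ} (hS : Disjoint S S') {F G : DirPoly}
    (hF : SupportedOn S F) (hG : SupportedOn S' G) {a b : ℕ} (ha : F.coeff a ≠ 0)
    (hb : G.coeff b ≠ 0) : (F * G).coeff (a * b) = F.coeff a * G.coeff b := by
  rw [MonoidAlgebra.coeff_mul, Finsupp.sum, Finset.sum_eq_single a, Finsupp.sum,
    Finset.sum_eq_single b, if_pos rfl]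
  · intro b' hb' hne
    rw [if_neg]
    intro h
    exact hne (mul_inj_of_supportedOn hS hF hG ha (Finsupp.mem_support_iff.1 hb') ha hb h).2
  · intro h; exact absurd (Finsupp.mem_support_iff.2 hb) h
  · intro a' ha' hne
    refine Finset.sum_eq_zero fun b' hb' => ?_
    dsimp only
    rw [if_neg]
    intro h
    exact hne (mul_inj_of_supportedOn hS hF hG (Finsupp.mem_support_iff.1 ha')
      (Finsupp.mem_support_iff.1 hb') ha hb h).1
  · intro h; exact absurd (Finsupp.mem_support_iff.2 ha) h

lemma pairing_self_eq_sum (F : DirPoly) :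
    pairing F F = ∑ n ∈ F.coeff.support, F.coeff n ^ 2 / n := by
  simp [pairing, Finsupp.sum, sq]

/-- Each index of the product comes from exactly one pair (a, b), so both its coefficient and the
weight 1/(ab) split. -/
lemma pairing_mul_self {S S' : Set ℕ} (hS : Disjoint S S') {F G : DirPoly}
    (hF : SupportedOn S F) (hG : SupportedOn S' G) :
    pairing (F * G) (F * G) = pairing F F * pairing G G := by
  classical
  have hsub : (F * G).coeff.support ⊆
      (F.coeff.support ×ˢ G.coeff.support).image fun x => x.1 * x.2 := by
    intro n hn
    obtain ⟨a, b, ha, hb, rfl⟩ := exists_of_coeff_mul_ne_zero (Finsupp.mem_support_iff.1 hn)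
    exact Finset.mem_image.2 ⟨(a, b), by simp [ha, hb], rfl⟩
  rw [pairing_self_eq_sum, pairing_self_eq_sum, pairing_self_eq_sum,
    Finset.sum_subset hsub (fun n _ hn => by rw [Finsupp.notMem_support_iff.1 hn]; simp),
    Finset.sum_image, Finset.sum_mul_sum, Finset.sum_product]
  · refine Finset.sum_congr rfl fun a ha => Finset.sum_congr rfl fun b hb => ?_
    dsimp only
    rw [coeff_mul_of_supportedOn hS hF hG (Finsupp.mem_support_iff.1 ha)
      (Finsupp.mem_support_iff.1 hb), Nat.cast_mul]
    ring
  · rintro ⟨a, b⟩ h1 ⟨a', b'⟩ h2 h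
    simp only [Finset.coe_product, Set.mem_prod, Finset.mem_coe, Finsupp.mem_support_iff] at h1 h2
    obtain ⟨h3, h4⟩ := mul_inj_of_supportedOn hS hF hG h1.1 h1.2 h2.1 h2.2 h
    rw [h3, h4]

lemma supportedOn_prod_biUnion {ι : Type*} (s : Finset ι) (F : ι → DirPoly) (S : ι → Set ℕ)
    (h : ∀ i ∈ s, SupportedOn (S i) (F i)) : SupportedOn (⋃ i ∈ s, S i) (∏ i ∈ s, F i) :=
  SupportedOn.prod s F fun i hi => (h i hi).mono (Set.subset_biUnion_of_mem (u := S) hi)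

lemma pairing_prod_self {ι : Type*} (s : Finset ι) (F : ι → DirPoly) (S : ι → Set ℕ)
    (h : ∀ i ∈ s, SupportedOn (S i) (F i)) (hd : (s : Set ι).PairwiseDisjoint S) :
    pairing (∏ i ∈ s, F i) (∏ i ∈ s, F i) = ∏ i ∈ s, pairing (F i) (F i) := by
  classical
  induction s using Finset.induction_on with
  | empty => simp [pairing, MonoidAlgebra.one_def]
  | insert a s ha ih =>
    have h' : ∀ i ∈ s, SupportedOn (S i) (F i) := fun i hi => h i (Finset.mem_insert_of_mem hi)
    rw [Finset.prod_insert ha, Finset.prod_insert ha, pairing_mul_self (S := S a)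
      (S' := ⋃ i ∈ s, S i) ?_ (h a (Finset.mem_insert_self _ _)) (supportedOn_prod_biUnion s F S h'),
      ih h' (hd.subset (by simp))]
    rw [Set.disjoint_iUnion₂_right]
    intro i hi
    exact hd (by simp) (by simp [hi]) (fun h => ha (h ▸ hi))

lemma coeff_mul_le_one {S S' : Set ℕ} (hS : Disjoint S S') {F G : DirPoly}
    (hF : SupportedOn S F) (hG : SupportedOn S' G) (hG0 : Nonneg G)
    (hF1 : ∀ n, F.coeff n ≤ 1) (hG1 : ∀ n, G.coeff n ≤ 1) (n : ℕ) : (F * G).coeff n ≤ 1 := by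
  by_cases hn : (F * G).coeff n = 0
  · rw [hn]; exact zero_le_one
  · obtain ⟨a, b, ha, hb, rfl⟩ := exists_of_coeff_mul_ne_zero hn
    rw [coeff_mul_of_supportedOn hS hF hG ha hb]
    exact mul_le_one₀ (hF1 a) (hG0 b) (hG1 b)

lemma coeff_one_le_one (n : ℕ) : (1 : DirPoly).coeff n ≤ 1 := by
  rw [MonoidAlgebra.one_def, MonoidAlgebra.coeff_single, Finsupp.single_apply]
  split_ifs <;> norm_num

lemma coeff_prod_le_one {ι : Type*} (s : Finset ι) (F : ι → DirPoly) (S : ι → Set ℕ)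
    (h : ∀ i ∈ s, SupportedOn (S i) (F i)) (hd : (s : Set ι).PairwiseDisjoint S)
    (h0 : ∀ i ∈ s, Nonneg (F i)) (h1 : ∀ i ∈ s, ∀ n, (F i).coeff n ≤ 1) (n : ℕ) :
    (∏ i ∈ s, F i).coeff n ≤ 1 := by
  classical
  induction s using Finset.induction_on generalizing n with
  | empty => exact coeff_one_le_one n
  | insert a s ha ih =>
    have h' : ∀ i ∈ s, SupportedOn (S i) (F i) := fun i hi => h i (Finset.mem_insert_of_mem hi)
    have h0' : ∀ i ∈ s, Nonneg (F i) := fun i hi => h0 i (Finset.mem_insert_of_mem hi)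
    rw [Finset.prod_insert ha]
    refine coeff_mul_le_one (S := S a) (S' := ⋃ i ∈ s, S i) ?_ (h a (Finset.mem_insert_self _ _))
      (supportedOn_prod_biUnion s F S h') (nonneg_prod s F h0') (h1 a (Finset.mem_insert_self _ _))
      (ih h' (hd.subset (by simp)) h0' fun i hi => h1 i (Finset.mem_insert_of_mem hi)) n
    rw [Set.disjoint_iUnion₂_right]
    intro i hi
    exact hd (by simp) (by simp [hi]) (fun h => ha (h ▸ hi))

/-! ### Powers of the linear polynomials: upper and lower bounds for coefficients. -/

/-- The Dirichlet polynomial `1 + c ∑_{p ∈ P} p ^ (-s)`. -/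
noncomputable def linear (P : Finset ℕ) (c : ℝ) : DirPoly :=
  1 + ∑ p ∈ P, MonoidAlgebra.single p c

lemma nonneg_linear (P : Finset ℕ) {c : ℝ} (hc : 0 ≤ c) : Nonneg (linear P c) :=
  nonneg_one.add (nonneg_sum _ _ fun p _ => nonneg_single p hc)

lemma coeff_linear_ne_zero {P : Finset ℕ} {c : ℝ} {n : ℕ} (h : (linear P c).coeff n ≠ 0) :
    n = 1 ∨ n ∈ P := by
  by_contra! hn
  apply h
  rw [linear, MonoidAlgebra.coeff_add, Finsupp.add_apply]
  have h1 : (1 : DirPoly).coeff n = 0 := by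
    by_contra h; exact hn.1 (coeff_one_ne_zero h)
  have h2 : (∑ p ∈ P, MonoidAlgebra.single p c : DirPoly).coeff n = 0 := by
    by_contra h
    obtain ⟨p, hp, h⟩ := exists_of_coeff_sum_ne_zero h
    exact hn.2 (coeff_single_ne_zero h ▸ hp)
  rw [h1, h2, add_zero]

lemma supportedOn_linear {P : Finset ℕ} (hP : ∀ p ∈ P, p.Prime) (c : ℝ) :
    SupportedOn P (linear P c) := fun n hn => by
  rcases coeff_linear_ne_zero hn with rfl | h
  · exact ⟨one_ne_zero, fun p hp h => absurd (Nat.dvd_one.1 h) hp.ne_one⟩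
  · refine ⟨(hP n h).ne_zero, fun p hp hpn => ?_⟩
    rw [(Nat.prime_dvd_prime_iff_eq hp (hP n h)).1 hpn]
    exact h

lemma supportLe_linear {P : Finset ℕ} {x : ℝ} (hx : 1 ≤ x) (hP : ∀ p ∈ P, (p : ℝ) ≤ x) (c : ℝ) :
    SupportLe x (linear P c) := fun n hn => by
  rcases coeff_linear_ne_zero hn with rfl | h
  · simpa using hx
  · exact hP n h

lemma total_linear_le {P : Finset ℕ} {x : ℝ} (hx : 1 ≤ x) (hP : ∀ p ∈ P, p.Prime ∧ (p : ℝ) ≤ x)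
    {c : ℝ} (hc1 : c ≤ 1) : total (linear P c) ≤ x := by
  have h1 : total (linear P c) = 1 + ∑ p ∈ P, c * absChar p := by
    simp [linear, total]
  have h2 : ∑ p ∈ P, c * absChar p ≤ P.card := by
    refine (Finset.sum_le_card_nsmul P _ 1 fun p _ => ?_).trans (by simp)
    exact mul_le_one₀ hc1 (absChar_nonneg p) (absChar_le_one p)
  have h3 : P ⊆ Finset.Icc 2 ⌊x⌋₊ := fun p hp =>
    Finset.mem_Icc.2 ⟨(hP p hp).1.two_le, Nat.le_floor (hP p hp).2⟩
  have h4 := Finset.card_le_card h3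
  rw [Nat.card_Icc] at h4
  have h5 : 1 ≤ ⌊x⌋₊ := Nat.le_floor (by simpa using hx)
  have h6 : P.card + 1 ≤ ⌊x⌋₊ := by omega
  have h7 : (P.card : ℝ) + 1 ≤ ⌊x⌋₊ := by exact_mod_cast h6
  have h8 := Nat.floor_le (show 0 ≤ x by linarith)
  linarith

/-- The linear polynomial is the part of degree at most one in the expanded product. The product is
a convenient majorant because it factors prime by prime. -/
lemma nonneg_prod_sub_linear (P : Finset ℕ) {c : ℝ} (hc : 0 ≤ c) :
    Nonneg (∏ p ∈ P, (1 + MonoidAlgebra.single p c) - linear P c) := by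
  classical
  induction P using Finset.induction_on with
  | empty => simpa [linear] using nonneg_zero
  | insert a s ha ih =>
    have h1 : Nonneg (MonoidAlgebra.single a c) := nonneg_single a hc
    have h2 : Nonneg (linear s c - 1) := by
      simpa [linear] using nonneg_sum s _ fun p _ => nonneg_single p hc
    have : ∏ p ∈ insert a s, (1 + MonoidAlgebra.single p c) - linear (insert a s) c =
        (1 + MonoidAlgebra.single a c) * (∏ p ∈ s, (1 + MonoidAlgebra.single p c) - linear s c)
          + MonoidAlgebra.single a c * (linear s c - 1) := by
      rw [Finset.prod_insert ha, linear, linear, Finset.sum_insert ha]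
      ring
    rw [this]
    exact ((nonneg_one.add h1).mul ih).add (h1.mul h2)

lemma one_add_single_pow (p s : ℕ) (c : ℝ) :
    (1 + MonoidAlgebra.single p c : DirPoly) ^ s =
      ∑ m ∈ Finset.range (s + 1), MonoidAlgebra.single (p ^ m) (c ^ m * s.choose m) := by
  rw [add_comm, add_pow]
  refine Finset.sum_congr rfl fun m _ => ?_
  rw [one_pow, mul_one, MonoidAlgebra.single_pow, MonoidAlgebra.natCast_def,
    MonoidAlgebra.single_mul_single, mul_one]

/-- The coefficient at p^m is C(s,m)/s^m, and C(s,m) ≤ s^m. This is what the normalization 1/s is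
for; for s = 0 the polynomial is 1. -/
lemma coeff_one_add_single_pow_le_one {p : ℕ} (hp : p.Prime) (s : ℕ) (n : ℕ) :
    ((1 + MonoidAlgebra.single p (1 / (s : ℝ)) : DirPoly) ^ s).coeff n ≤ 1 := by
  rw [one_add_single_pow, MonoidAlgebra.coeff_sum, Finsupp.finsetSum_apply]
  simp only [MonoidAlgebra.coeff_single, Finsupp.single_apply]
  have hle : ∀ m : ℕ, (1 / (s : ℝ)) ^ m * s.choose m ≤ 1 := by
    intro m
    rcases Nat.eq_zero_or_pos s with rfl | hs
    · rcases Nat.eq_zero_or_pos m with rfl | hm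
      · simp
      · simp [hm.ne']
    · have hs' : (0 : ℝ) < s := by exact_mod_cast hs
      rw [one_div, inv_pow, inv_mul_le_iff₀ (by positivity), mul_one]
      exact_mod_cast Nat.choose_le_pow s m
  by_cases h : ∃ m ∈ Finset.range (s + 1), p ^ m = n
  · obtain ⟨m, hm, rfl⟩ := h
    rw [Finset.sum_eq_single m]
    · simpa using hle m
    · intro j _ hj
      rw [if_neg]
      exact fun h => hj (Nat.pow_right_injective hp.two_le h)
    · exact fun h => absurd hm h
  · push Not at h
    rw [Finset.sum_eq_zero]
    · exact zero_le_one
    · intro m hm; rw [if_neg (h m hm)]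

lemma supportedOn_one_add_single {p : ℕ} (hp : p.Prime) (c : ℝ) :
    SupportedOn {p} (1 + MonoidAlgebra.single p c) := by
  simpa [linear] using supportedOn_linear (P := {p}) (by simpa using hp) c

/-- The coefficients of a product of `s i`-th powers of `1 + (1 / s i) ∑_{p ∈ P i} p ^ (-s)`
over disjoint sets of primes are at most one. -/
lemma coeff_prod_linear_pow_le_one {ι : Type*} (I : Finset ι) (P : ι → Finset ℕ) (s : ι → ℕ)
    (hP : ∀ i ∈ I, ∀ p ∈ P i, p.Prime)
    (hd : (I : Set ι).PairwiseDisjoint fun i => (P i : Set ℕ)) (n : ℕ) :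
    (∏ i ∈ I, linear (P i) (1 / (s i : ℝ)) ^ s i).coeff n ≤ 1 := by
  have hc : ∀ i, 0 ≤ 1 / (s i : ℝ) := fun i => by positivity
  have hsn : ∀ i p, Nonneg (1 + MonoidAlgebra.single p (1 / (s i : ℝ))) := fun i p =>
    nonneg_one.add (nonneg_single p (hc i))
  -- Pass to the Euler-type majorant, whose coefficients can be bounded one prime at a time.
  have hle : Nonneg (∏ i ∈ I, (∏ p ∈ P i, (1 + MonoidAlgebra.single p (1 / (s i : ℝ))) ^ s i)
      - ∏ i ∈ I, linear (P i) (1 / (s i : ℝ)) ^ s i) := by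
    refine nonneg_prod_sub_prod I _ _ (fun i _ => (nonneg_linear _ (hc i)).pow _) fun i _ => ?_
    rw [Finset.prod_pow]
    simpa using nonneg_prod_sub_prod (Finset.range (s i)) (fun _ => linear (P i) (1 / (s i : ℝ)))
      (fun _ => ∏ p ∈ P i, (1 + MonoidAlgebra.single p (1 / (s i : ℝ))))
      (fun _ _ => nonneg_linear _ (hc i)) (fun _ _ => nonneg_prod_sub_linear _ (hc i))
  refine (nonneg_sub_iff.1 hle n).trans ?_
  have hS : ∀ i ∈ I, ∀ p ∈ P i, SupportedOn {p}
      ((1 + MonoidAlgebra.single p (1 / (s i : ℝ))) ^ s i) := fun i hi p hp =>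
    (supportedOn_one_add_single (hP i hi p hp) _).pow _
  refine coeff_prod_le_one I _ (fun i => (P i : Set ℕ)) ?_ hd ?_ ?_ n
  · exact fun i hi => SupportedOn.prod _ _ fun p hp => (hS i hi p hp).mono (by simpa using hp)
  · exact fun i _ => nonneg_prod _ _ fun p _ => (hsn i p).pow _
  · intro i hi
    refine coeff_prod_le_one (P i) _ (fun p => {p}) (hS i hi) ?_ (fun p _ => (hsn i p).pow _)
      fun p hp => coeff_one_add_single_pow_le_one (hP i hi p hp) _
    intro p _ q _ hpq
    simpa using hpq

lemma coeff_mul_linear (F : DirPoly) (P : Finset ℕ) (c : ℝ) (n : ℕ) :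
    (F * linear P c).coeff n =
      F.coeff n + ∑ p ∈ P, (F * MonoidAlgebra.single p c).coeff n := by
  rw [linear, mul_add, mul_one, Finset.mul_sum, MonoidAlgebra.coeff_add, Finsupp.add_apply,
    MonoidAlgebra.coeff_sum, Finsupp.finsetSum_apply]

lemma descFactorial_succ_le (r m : ℕ) :
    (r + 1).descFactorial (m + 1) ≤ r.descFactorial (m + 1) + (m + 1) * r.descFactorial m := by
  rw [Nat.succ_descFactorial_succ, Nat.descFactorial_succ, ← add_mul]
  exact Nat.mul_le_mul_right _ (by omega)

/-- Each prime of `S` must be supplied by its own factor among the r, which can happen in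
r(r-1)⋯(r-|S|+1) ways. In the induction the last factor supplies either 1 or one prime of `S`, and
`descFactorial_succ_le` is the matching recursion. -/
lemma le_coeff_linear_pow {P : Finset ℕ} (hP : ∀ p ∈ P, p.Prime) {c : ℝ} (hc : 0 ≤ c) (r : ℕ)
    {S : Finset ℕ} (hS : S ⊆ P) :
    c ^ S.card * r.descFactorial S.card ≤ (linear P c ^ r).coeff (∏ p ∈ S, p) := by
  induction r generalizing S with
  | zero =>
    rcases S.eq_empty_or_nonempty with rfl | h
    · simp
    · obtain ⟨m, hm⟩ := Nat.exists_eq_succ_of_ne_zero (Finset.card_ne_zero_of_mem h.choose_spec)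
      rw [hm, Nat.zero_descFactorial_succ, Nat.cast_zero, mul_zero, pow_zero]
      exact nonneg_one _
  | succ r ih =>
    have hn := (nonneg_linear P hc).pow r
    rw [pow_succ, coeff_mul_linear]
    have h1 : ∑ p ∈ S, c * (c ^ (S.card - 1) * r.descFactorial (S.card - 1)) ≤
        ∑ p ∈ P, (linear P c ^ r * MonoidAlgebra.single p c).coeff (∏ p ∈ S, p) := by
      refine (Finset.sum_le_sum fun p hp => ?_).trans (Finset.sum_le_sum_of_subset_of_nonneg hS
        fun p _ _ => hn.mul (nonneg_single p hc) _)
      have e := MonoidAlgebra.coeff_mul_single_eq_coeff_mul (x := linear P c ^ r) (m := p)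
        (m₁ := ∏ p ∈ S, p) (r := c) (∏ p ∈ S.erase p, p) (by
          intro a _
          rw [← Finset.prod_erase_mul S _ hp]
          exact Nat.mul_left_inj (hP p (hS hp)).ne_zero)
      rw [e, mul_comm c]
      refine mul_le_mul_of_nonneg_right ?_ hc
      rw [← Finset.card_erase_of_mem hp]
      exact ih ((Finset.erase_subset _ _).trans hS)
    refine le_trans ?_ (add_le_add (ih hS) h1)
    rw [Finset.sum_const, nsmul_eq_mul]
    rcases Nat.eq_zero_or_pos S.card with h0 | h0
    · simp [h0]
    · obtain ⟨m, hm⟩ := Nat.exists_eq_succ_of_ne_zero h0.ne'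
      rw [hm, Nat.succ_sub_one]
      have : ((r + 1).descFactorial (m + 1) : ℝ) ≤
          r.descFactorial (m + 1) + (m + 1) * r.descFactorial m := by
        exact_mod_cast descFactorial_succ_le r m
      calc c ^ (m + 1) * ((r + 1).descFactorial (m + 1) : ℝ) ≤
          c ^ (m + 1) * (r.descFactorial (m + 1) + (m + 1) * r.descFactorial m) := by gcongr
        _ = _ := by rw [Nat.succ_eq_add_one]; push_cast; ring

lemma prod_primes_injOn {P : Finset ℕ} (hP : ∀ p ∈ P, p.Prime) :
    Set.InjOn (fun S : Finset ℕ => ∏ p ∈ S, p) (P.powerset : Set (Finset ℕ)) := by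
  have key : ∀ S ∈ P.powerset, ∀ T ∈ P.powerset, ∏ p ∈ S, p = ∏ p ∈ T, p → S ⊆ T := by
    intro S hS T hT h p hp
    have hpp := hP p (Finset.mem_powerset.1 hS hp)
    have : p ∣ ∏ q ∈ T, q := h ▸ Finset.dvd_prod_of_mem _ hp
    obtain ⟨q, hq, hpq⟩ := (Prime.dvd_finsetProd_iff hpp.prime _).1 this
    rwa [(Nat.prime_dvd_prime_iff_eq hpp (hP q (Finset.mem_powerset.1 hT hq))).1 hpq]
  intro S hS T hT h
  exact (key S hS T hT h).antisymm (key T hT S hS h.symm)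

/-- Keep only the squarefree indices in the mean square; distinct subsets give distinct products. -/
lemma sum_powerset_le_pairing {P : Finset ℕ} (hP : ∀ p ∈ P, p.Prime) {c : ℝ} (hc : 0 ≤ c) (r : ℕ) :
    ∑ S ∈ P.powerset, (c ^ S.card * r.descFactorial S.card) ^ 2 * ∏ p ∈ S, (1 / (p : ℝ)) ≤
      pairing (linear P c ^ r) (linear P c ^ r) := by
  classical
  set F := linear P c ^ r
  have hF : Nonneg F := (nonneg_linear P hc).pow r
  calc ∑ S ∈ P.powerset, (c ^ S.card * r.descFactorial S.card) ^ 2 * ∏ p ∈ S, (1 / (p : ℝ))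
      ≤ ∑ S ∈ P.powerset, F.coeff (∏ p ∈ S, p) ^ 2 / ((∏ p ∈ S, p : ℕ) : ℝ) := by
        refine Finset.sum_le_sum fun S hS => ?_
        rw [Finset.prod_div_distrib, Finset.prod_const_one, mul_one_div, Nat.cast_prod]
        gcongr
        exact le_coeff_linear_pow hP hc r (Finset.mem_powerset.1 hS)
    _ = ∑ n ∈ P.powerset.image (fun S => ∏ p ∈ S, p), F.coeff n ^ 2 / (n : ℝ) := by
        rw [Finset.sum_image (prod_primes_injOn hP)]
    _ ≤ ∑ n ∈ P.powerset.image (fun S => ∏ p ∈ S, p) ∪ F.coeff.support, F.coeff n ^ 2 / (n : ℝ) :=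
        Finset.sum_le_sum_of_subset_of_nonneg Finset.subset_union_left fun n _ _ => by positivity
    _ = pairing F F := by
        rw [pairing_self_eq_sum]
        symm
        refine Finset.sum_subset Finset.subset_union_right fun n _ hn => ?_
        rw [Finsupp.notMem_support_iff.1 hn]; simp

end DirPoly

/-! ### Mean square over one set of primes. -/

/-- Second factorial moment of the size of a random subset with independent inclusions. -/
lemma sum_powerset_card_mul_le {ι : Type*} (P : Finset ι) (f : ι → ℝ)
    (hf : ∀ i ∈ P, 0 ≤ f i) :
    ∑ S ∈ P.powerset, ((S.card : ℝ) * (S.card - 1)) * ∏ i ∈ S, f i ≤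
      (∑ i ∈ P, f i) ^ 2 * ∏ i ∈ P, (1 + f i) := by
  classical
  -- Adding an element to the ground set brings the first moment into the recursion for the second,
  -- so both bounds are proved together.
  have key : (∑ S ∈ P.powerset, (S.card : ℝ) * ∏ i ∈ S, f i ≤ (∑ i ∈ P, f i) * ∏ i ∈ P, (1 + f i)) ∧
    ∑ S ∈ P.powerset, ((S.card : ℝ) * (S.card - 1)) * ∏ i ∈ S, f i ≤
      (∑ i ∈ P, f i) ^ 2 * ∏ i ∈ P, (1 + f i) := by
    induction P using Finset.induction_on with
    | empty => simp
    | insert a s ha ih =>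
      obtain ⟨ih1, ih2⟩ := ih fun i hi => hf i (Finset.mem_insert_of_mem hi)
      have hfa := hf a (Finset.mem_insert_self _ _)
      have hσ : 0 ≤ ∑ i ∈ s, f i := Finset.sum_nonneg fun i hi => hf i (Finset.mem_insert_of_mem hi)
      have hZ : 0 ≤ ∏ i ∈ s, (1 + f i) := Finset.prod_nonneg fun i hi =>
        add_nonneg zero_le_one (hf i (Finset.mem_insert_of_mem hi))
      have hne : ∀ S ∈ s.powerset, a ∉ S := fun S hS h => ha (Finset.mem_powerset.1 hS h)
      have e1 : ∑ S ∈ s.powerset, ((insert a S).card : ℝ) * ∏ i ∈ insert a S, f i =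
          f a * ∑ S ∈ s.powerset, (S.card : ℝ) * ∏ i ∈ S, f i + f a * ∏ i ∈ s, (1 + f i) := by
        rw [Finset.prod_one_add, Finset.mul_sum, Finset.mul_sum, ← Finset.sum_add_distrib]
        refine Finset.sum_congr rfl fun S hS => ?_
        rw [Finset.card_insert_of_notMem (hne S hS), Finset.prod_insert (hne S hS)]
        push_cast; ring
      have e2 : ∑ S ∈ s.powerset, (((insert a S).card : ℝ) * ((insert a S).card - 1)) *
          ∏ i ∈ insert a S, f i =
          f a * ∑ S ∈ s.powerset, ((S.card : ℝ) * (S.card - 1)) * ∏ i ∈ S, f i +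
            2 * f a * ∑ S ∈ s.powerset, (S.card : ℝ) * ∏ i ∈ S, f i := by
        rw [Finset.mul_sum, Finset.mul_sum, ← Finset.sum_add_distrib]
        refine Finset.sum_congr rfl fun S hS => ?_
        rw [Finset.card_insert_of_notMem (hne S hS), Finset.prod_insert (hne S hS)]
        push_cast; ring
      rw [Finset.sum_powerset_insert ha, Finset.sum_powerset_insert ha, e1, e2,
        Finset.sum_insert ha, Finset.prod_insert ha]
      set σ := ∑ i ∈ s, f i
      set Z := ∏ i ∈ s, (1 + f i)
      set A := ∑ S ∈ s.powerset, (S.card : ℝ) * ∏ i ∈ S, f i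
      set B := ∑ S ∈ s.powerset, ((S.card : ℝ) * (S.card - 1)) * ∏ i ∈ S, f i
      constructor
      · have h1 := mul_le_mul_of_nonneg_left ih1 (show 0 ≤ 1 + f a by linarith)
        have h2 : 0 ≤ f a * f a * Z := by positivity
        nlinarith
      · have h1 := mul_le_mul_of_nonneg_left ih2 (show 0 ≤ 1 + f a by linarith)
        have h2 := mul_le_mul_of_nonneg_left ih1 (show 0 ≤ 2 * f a by linarith)
        have h3 : 0 ≤ f a * f a * Z * (1 + f a) := by positivity
        have h4 : 0 ≤ 2 * f a * σ * Z * f a := by positivity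
        nlinarith
  exact key.2

/-- The birthday bound: the quotient is ∏_{j<m}(1 - j/r) ≥ 1 - ∑_{j<m} j/r. -/
lemma one_sub_le_descFactorial_div_pow {r : ℕ} (hr : 0 < r) (m : ℕ) :
    1 - (m : ℝ) * (m - 1) / (2 * r) ≤ r.descFactorial m / (r : ℝ) ^ m := by
  have hr' : (0 : ℝ) < r := by exact_mod_cast hr
  induction m with
  | zero => simp
  | succ m ih =>
    have h1 : (r.descFactorial m : ℝ) / (r : ℝ) ^ m ≤ 1 := by
      rw [div_le_one (by positivity)]
      exact_mod_cast Nat.descFactorial_le_pow r m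
    have h0 : 0 ≤ (r.descFactorial m : ℝ) / (r : ℝ) ^ m := by positivity
    have h2 : (1 - m / r : ℝ) * (r.descFactorial m / (r : ℝ) ^ m) ≤
        r.descFactorial (m + 1) / (r : ℝ) ^ (m + 1) := by
      rw [Nat.descFactorial_succ, Nat.cast_mul, pow_succ, mul_comm ((r : ℝ) ^ m), mul_div_mul_comm]
      gcongr
      rw [one_sub_div hr'.ne']
      gcongr
      have : r ≤ (r - m) + m := by omega
      have : (r : ℝ) ≤ ((r - m : ℕ) : ℝ) + m := by exact_mod_cast this
      linarith
    refine le_trans ?_ h2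
    have h3 : (m / r : ℝ) * (r.descFactorial m / (r : ℝ) ^ m) ≤ m / r :=
      mul_le_of_le_one_right (by positivity) h1
    have h4 : ((m + 1 : ℕ) : ℝ) * (((m + 1 : ℕ) : ℝ) - 1) / (2 * r) = m * (m - 1) / (2 * r) + m / r := by
      push_cast; field_simp; ring
    rw [h4]
    linarith

namespace DirPoly

/-- Lower bound for the mean square of `(1 + (1 / s) ∑_{p ∈ P} p ^ (-1/2 - it)) ^ r`. -/
lemma prod_mul_le_pairing {P : Finset ℕ} (hP : ∀ p ∈ P, p.Prime) {s r : ℕ}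
    (hr : 0 < r) :
    (∏ p ∈ P, (1 + (r / s : ℝ) ^ 2 / p)) * (1 - (∑ p ∈ P, (r / s : ℝ) ^ 2 / p) ^ 2 / r) ≤
      pairing (linear P (1 / (s : ℝ)) ^ r) (linear P (1 / (s : ℝ)) ^ r) := by
  have hr' : (0 : ℝ) < r := by exact_mod_cast hr
  set κ : ℝ := (r / s : ℝ) with hκ
  refine le_trans ?_ (sum_powerset_le_pairing hP (by positivity) r)
  have h1 := sum_powerset_card_mul_le P (fun p : ℕ => κ ^ 2 / (p : ℝ)) (fun p _ => by positivity)
  have h2 : ∀ S ∈ P.powerset, (∏ p ∈ S, κ ^ 2 / (p : ℝ)) -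
      (((S.card : ℝ) * (S.card - 1)) * ∏ p ∈ S, κ ^ 2 / (p : ℝ)) / r ≤
      ((1 / (s : ℝ)) ^ S.card * r.descFactorial S.card) ^ 2 * ∏ p ∈ S, (1 / (p : ℝ)) := by
    intro S _
    set m := S.card
    set u : ℝ := r.descFactorial m / (r : ℝ) ^ m with hu
    have hu1 := one_sub_le_descFactorial_div_pow hr m
    rw [← hu] at hu1
    have e1 : ∏ p ∈ S, κ ^ 2 / (p : ℝ) = (κ ^ m) ^ 2 * ∏ p ∈ S, (1 / (p : ℝ)) := by
      simp only [div_eq_mul_one_div (κ ^ 2)]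
      rw [Finset.prod_mul_distrib, Finset.prod_const, ← pow_mul, ← pow_mul, mul_comm 2]
    have e2 : (1 / (s : ℝ)) ^ m * r.descFactorial m = κ ^ m * u := by
      rw [hu, hκ, div_pow, div_pow, one_pow]; field_simp
    rw [e1, e2]
    -- From u² ≥ 2u - 1 and the birthday bound.
    have h3 : 1 - (m : ℝ) * (m - 1) / r ≤ u ^ 2 := by
      have : (m : ℝ) * (m - 1) / (2 * r) = (m : ℝ) * (m - 1) / r / 2 := by field_simp
      nlinarith [sq_nonneg (u - 1)]
    calc (κ ^ m) ^ 2 * ∏ p ∈ S, (1 / (p : ℝ)) -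
        (((m : ℝ) * (m - 1)) * ((κ ^ m) ^ 2 * ∏ p ∈ S, (1 / (p : ℝ)))) / r
        = (κ ^ m) ^ 2 * (∏ p ∈ S, (1 / (p : ℝ))) * (1 - (m : ℝ) * (m - 1) / r) := by ring
      _ ≤ (κ ^ m) ^ 2 * (∏ p ∈ S, (1 / (p : ℝ))) * u ^ 2 :=
          mul_le_mul_of_nonneg_left h3 (mul_nonneg (by positivity)
            (Finset.prod_nonneg fun p _ => by positivity))
      _ = _ := by ring
  refine le_trans ?_ (Finset.sum_le_sum h2)
  rw [Finset.sum_sub_distrib, ← Finset.sum_div, ← Finset.prod_one_add, mul_sub, mul_one]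
  rw [sub_le_sub_iff_left, div_le_iff₀ hr']
  refine h1.trans (le_of_eq ?_)
  field_simp

end DirPoly

/-! ### Mertens' estimates. -/

/-- There are ⌊n/p⌋ multiples of p up to n, which is the first term of Legendre's formula; powers of
distinct primes are coprime. -/
lemma prod_primesLE_pow_div_dvd_factorial (n : ℕ) : ∏ p ∈ n.primesLE, p ^ (n / p) ∣ n.factorial := by
  refine Finset.prod_dvd_of_isRelPrime ?_ ?_
  · intro p hp q hq hpq
    have hp' := (Nat.mem_primesLE.1 hp).2
    have hq' := (Nat.mem_primesLE.1 hq).2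
    exact Nat.coprime_iff_isRelPrime.1 (Nat.Coprime.pow _ _ ((Nat.coprime_primes hp' hq').2 hpq))
  · intro p hp
    have hp' := (Nat.mem_primesLE.1 hp).2
    rw [hp'.pow_dvd_factorial_iff (b := Nat.log p n + 2) (by omega)]
    simpa using Finset.single_le_sum (f := fun i => n / p ^ i) (fun i _ => Nat.zero_le _)
      (show 1 ∈ Finset.Ico 1 (Nat.log p n + 2) by simp)

/-- Upper bound in Mertens' first theorem. -/
lemma sum_primesLE_log_div_le {n : ℕ} (hn : 0 < n) :
    ∑ p ∈ n.primesLE, Real.log p / p ≤ Real.log n + Real.log 4 := by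
  have hn' : (0 : ℝ) < n := by exact_mod_cast hn
  have h1 : ∑ p ∈ n.primesLE, ((n / p : ℕ) : ℝ) * Real.log p ≤ n * Real.log n := by
    have h := (Nat.le_of_dvd n.factorial_pos (prod_primesLE_pow_div_dvd_factorial n)).trans
      n.factorial_le_pow
    have h' : ((∏ p ∈ n.primesLE, p ^ (n / p) : ℕ) : ℝ) ≤ (n : ℝ) ^ n := by exact_mod_cast h
    have hne : ∀ p ∈ n.primesLE, (p : ℝ) ^ (n / p) ≠ 0 := fun p hp => by
      have := (Nat.mem_primesLE.1 hp).2.ne_zero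
      positivity
    rw [Nat.cast_prod] at h'
    simp only [Nat.cast_pow] at h'
    have h0 : (0 : ℝ) < ∏ p ∈ n.primesLE, (p : ℝ) ^ (n / p) :=
      Finset.prod_pos fun p hp => lt_of_le_of_ne (by positivity) (hne p hp).symm
    have := Real.log_le_log h0 h'
    rw [Real.log_prod hne, Real.log_pow] at this
    simpa only [Real.log_pow] using this
  -- Chebyshev's bound pays for replacing ⌊n/p⌋ by n/p.
  have h2 : ∑ p ∈ n.primesLE, Real.log p ≤ Real.log 4 * n := by
    rw [← Chebyshev.theta_eq_sum_primesLE_log]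
    exact Chebyshev.theta_le_log4_mul_x hn'.le
  have h3 : ∑ p ∈ n.primesLE, n * (Real.log p / p) ≤
      ∑ p ∈ n.primesLE, (((n / p : ℕ) : ℝ) * Real.log p + Real.log p) := by
    refine Finset.sum_le_sum fun p hp => ?_
    have hp' := (Nat.mem_primesLE.1 hp).2
    have hlog : 0 ≤ Real.log p := Real.log_natCast_nonneg p
    have h4 : (n : ℝ) / p ≤ ((n / p : ℕ) : ℝ) + 1 := by
      rw [div_le_iff₀ (by exact_mod_cast hp'.pos)]
      have := Nat.lt_mul_div_succ n hp'.pos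
      have h5 : n ≤ (n / p + 1) * p := by rw [mul_comm]; exact this.le
      exact_mod_cast h5
    calc n * (Real.log p / p) = n / p * Real.log p := by ring
      _ ≤ (((n / p : ℕ) : ℝ) + 1) * Real.log p := by gcongr
      _ = _ := by ring
  rw [← Finset.mul_sum, Finset.sum_add_distrib] at h3
  have h4 : n * ∑ p ∈ n.primesLE, Real.log p / p ≤ n * (Real.log n + Real.log 4) := by linarith
  exact le_of_mul_le_mul_left h4 hn'

lemma sum_one_div_mul_sub_one_le {s : Finset ℕ} (hs : ∀ m ∈ s, 2 ≤ m) :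
    ∑ m ∈ s, 1 / ((m : ℝ) * (m - 1)) ≤ 1 := by
  have key : ∀ n : ℕ, ∑ m ∈ Finset.Icc 2 (n + 1), 1 / ((m : ℝ) * (m - 1)) = 1 - 1 / (n + 1 : ℝ) := by
    intro n
    induction n with
    | zero => simp
    | succ n ih =>
      rw [Finset.sum_Icc_succ_top (by omega), ih]
      push_cast
      have : (n : ℝ) + 1 + 1 - 1 ≠ 0 := by
        have : (0 : ℝ) < n + 1 := by positivity
        linarith
      field_simp
      ring
  have hsub : s ⊆ Finset.Icc 2 (s.sup id + 1) := fun m hm => by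
    have : m ≤ s.sup id := Finset.le_sup (f := id) hm
    exact Finset.mem_Icc.2 ⟨hs m hm, by omega⟩
  refine (Finset.sum_le_sum_of_subset_of_nonneg hsub ?_).trans ((key _).le.trans ?_)
  · intro m hm _
    have : (2 : ℝ) ≤ m := by exact_mod_cast (Finset.mem_Icc.1 hm).1
    exact div_nonneg zero_le_one (mul_nonneg (by linarith) (by linarith))
  · have : 0 ≤ 1 / ((s.sup id : ℕ) + 1 : ℝ) := by positivity
    linarith

lemma sum_one_div_sq_le {s : Finset ℕ} (hs : ∀ m ∈ s, 2 ≤ m) :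
    ∑ m ∈ s, 1 / (m : ℝ) ^ 2 ≤ 1 := by
  refine (Finset.sum_le_sum fun m hm => ?_).trans (sum_one_div_mul_sub_one_le hs)
  have : (2 : ℝ) ≤ m := by exact_mod_cast hs m hm
  apply one_div_le_one_div_of_le <;> nlinarith

/-- Lower bound in Mertens' second theorem. -/
lemma log_log_le_sum_primesLE {n : ℕ} (hn : 2 ≤ n) :
    Real.log (Real.log (n + 1 : ℕ)) ≤ ∑ p ∈ n.primesLE, 1 / (p : ℝ) + 1 := by
  have hp2 : ∀ p ∈ n.primesLE, (2 : ℝ) ≤ p := fun p hp => by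
    exact_mod_cast (Nat.mem_primesLE.1 hp).2.two_le
  let f : ℕ →* ℝ :=
    { toFun := fun m => (m : ℝ)⁻¹
      map_one' := by simp
      map_mul' := fun a b => by rw [Nat.cast_mul, mul_inv] }
  have hf : ∀ {p : ℕ}, p.Prime → ‖f p‖ < 1 := fun {p} hp => by
    have : (1 : ℝ) < p := by exact_mod_cast hp.one_lt
    simp only [f, MonoidHom.coe_mk, OneHom.coe_mk, norm_inv, Real.norm_natCast]
    exact inv_lt_one_of_one_lt₀ this
  obtain ⟨-, h1⟩ := EulerProduct.summable_and_hasSum_smoothNumbers_prod_primesBelow_geometric hf (n + 1)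
  have h2 : Real.log (n + 1 : ℕ) ≤ ∏ p ∈ n.primesLE, (1 - f p)⁻¹ := by
    refine (log_add_one_le_harmonic n).trans ?_
    rw [harmonic_eq_sum_Icc]
    push_cast
    -- Every m ≤ n is (n+1)-smooth, so the Euler product over primes up to n dominates the harmonic
    -- sum.
    let g : Finset (Nat.smoothNumbers (n + 1)) := (Finset.Icc 1 n).attach.map
      ⟨fun m => ⟨m.1, Nat.mem_smoothNumbers_of_lt (Finset.mem_Icc.1 m.2).1
        (by have := (Finset.mem_Icc.1 m.2).2; omega)⟩, fun a b h => Subtype.ext (Subtype.mk.inj h)⟩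
    have h3 := sum_le_hasSum g (fun m _ => by
      simp only [f, MonoidHom.coe_mk, OneHom.coe_mk]; positivity) h1
    refine le_trans (le_of_eq ?_) h3
    rw [Finset.sum_map, ← Finset.sum_attach]
    rfl
  have hlogpos : 0 < Real.log (n + 1 : ℕ) := Real.log_pos (by push_cast; exact_mod_cast (by omega))
  have h3 := Real.log_le_log hlogpos h2
  have hpos : ∀ p ∈ n.primesLE, 0 < 1 - f p := fun p hp => by
    have := hf (Nat.mem_primesLE.1 hp).2
    have := (le_abs_self (f p)).trans_lt this
    linarith
  rw [Real.log_prod fun p hp => (inv_pos.2 (hpos p hp)).ne'] at h3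
  -- Uses -log(1 - 1/p) ≤ 1/(p-1) = 1/p + 1/(p(p-1)). The last terms sum to at most 1, whence the
  -- additive 1 in the statement.
  have h4 : ∀ p ∈ n.primesLE, Real.log (1 - f p)⁻¹ ≤ 1 / (p : ℝ) + 1 / ((p : ℝ) * (p - 1)) := by
    intro p hp
    have h5 := Real.one_sub_inv_le_log_of_pos (hpos p hp)
    rw [Real.log_inv]
    have h6 := hp2 p hp
    have h7 : (1 - f p)⁻¹ = p / (p - 1) := by
      simp only [f, MonoidHom.coe_mk, OneHom.coe_mk]
      have : (p : ℝ) - 1 ≠ 0 := by linarith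
      have : (1 - (p : ℝ)⁻¹) ≠ 0 := (hpos p hp).ne'
      field_simp
    have h8 : (p : ℝ) / (p - 1) - 1 = 1 / (p : ℝ) + 1 / ((p : ℝ) * (p - 1)) := by
      have : (p : ℝ) - 1 ≠ 0 := by linarith
      field_simp; ring
    rw [← h8, ← h7]; linarith
  have h5 := h3.trans (Finset.sum_le_sum h4)
  rw [Finset.sum_add_distrib] at h5
  have h6 := sum_one_div_mul_sub_one_le (s := n.primesLE) fun p hp =>
    (Nat.mem_primesLE.1 hp).2.two_le
  linarith

/-! ### Blocks of primes. -/

/-- The primes in the interval `(exp (L / 4 ^ (i + 1)), exp (L / 4 ^ i)]`. -/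
noncomputable def primeBlock (L : ℝ) (i : ℕ) : Finset ℕ :=
  (⌊Real.exp (L / 4 ^ i)⌋₊.primesLE).filter fun p => Real.exp (L / 4 ^ (i + 1)) < p

lemma mem_primeBlock {L : ℝ} {i p : ℕ} : p ∈ primeBlock L i ↔
    p.Prime ∧ (p : ℝ) ≤ Real.exp (L / 4 ^ i) ∧ Real.exp (L / 4 ^ (i + 1)) < p := by
  rw [primeBlock, Finset.mem_filter, Nat.mem_primesLE, Nat.le_floor_iff (Real.exp_pos _).le]
  tauto

/-- On the block log p ≥ ℓ/4, so the sum is at most (4/ℓ) ∑ log p / p ≤ (4/ℓ)(ℓ + log 4). If e^ℓ < 2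
the block is empty; otherwise log 4 ≤ 2ℓ. -/
lemma sum_primeBlock_le {L : ℝ} (i : ℕ) :
    ∑ p ∈ primeBlock L i, 1 / (p : ℝ) ≤ 12 := by
  set ℓ : ℝ := L / 4 ^ i with hℓ
  have hℓ4 : L / 4 ^ (i + 1) = ℓ / 4 := by rw [hℓ, pow_succ, div_div]
  rcases lt_or_ge (Real.exp ℓ) 2 with h | h
  · rw [Finset.sum_eq_zero]
    · norm_num
    · intro p hp
      exfalso
      obtain ⟨h1, h2, -⟩ := mem_primeBlock.1 hp
      have : (2 : ℝ) ≤ p := by exact_mod_cast h1.two_le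
      linarith
  · have hlog2 : Real.log 2 ≤ ℓ := by
      rw [← Real.log_exp ℓ]; exact Real.log_le_log two_pos h
    have h2pos : 0 < Real.log 2 := Real.log_pos one_lt_two
    have hℓ0 : 0 < ℓ := lt_of_lt_of_le h2pos hlog2
    have hfl : 0 < ⌊Real.exp ℓ⌋₊ := Nat.floor_pos.2 (by linarith)
    have h1 : ∑ p ∈ primeBlock L i, 1 / (p : ℝ) ≤
        ∑ p ∈ primeBlock L i, 4 / ℓ * (Real.log p / p) := by
      refine Finset.sum_le_sum fun p hp => ?_
      obtain ⟨hp1, hp2, hp3⟩ := mem_primeBlock.1 hp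
      have hp0 : (0 : ℝ) < p := by exact_mod_cast hp1.pos
      rw [hℓ4] at hp3
      have : ℓ / 4 ≤ Real.log p := by
        rw [← Real.log_exp (ℓ / 4)]; exact Real.log_le_log (Real.exp_pos _) hp3.le
      rw [div_mul_div_comm, div_le_div_iff₀ hp0 (by positivity)]
      nlinarith
    have h2 : ∑ p ∈ primeBlock L i, 4 / ℓ * (Real.log p / p) ≤
        ∑ p ∈ ⌊Real.exp ℓ⌋₊.primesLE, 4 / ℓ * (Real.log p / p) :=
      Finset.sum_le_sum_of_subset_of_nonneg (Finset.filter_subset _ _) fun p _ _ =>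
        mul_nonneg (by positivity) (div_nonneg (Real.log_natCast_nonneg p) (by positivity))
    have h3 := sum_primesLE_log_div_le hfl
    have h4 : Real.log ⌊Real.exp ℓ⌋₊ ≤ ℓ := by
      rw [← Real.log_exp ℓ]
      have := Nat.floor_le (Real.exp_pos ℓ).le
      rw [Real.log_exp]
      exact (Real.log_le_log (by exact_mod_cast hfl) this).trans (Real.log_exp ℓ).le
    have h5 : Real.log 4 = 2 * Real.log 2 := by
      rw [show (4 : ℝ) = 2 ^ 2 by norm_num, Real.log_pow]; norm_num
    rw [← Finset.mul_sum] at h1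
    rw [← Finset.mul_sum, ← Finset.mul_sum] at h2
    refine h1.trans (h2.trans ?_)
    calc 4 / ℓ * ∑ p ∈ ⌊Real.exp ℓ⌋₊.primesLE, Real.log p / p ≤ 4 / ℓ * (3 * ℓ) := by
          gcongr; linarith
      _ = 12 := by field_simp; norm_num

lemma disjoint_primeBlock {L : ℝ} (hL : 0 ≤ L) {i j : ℕ} (hij : i ≠ j) :
    Disjoint (primeBlock L i) (primeBlock L j) := by
  have key : ∀ i j : ℕ, i < j → ∀ p, p ∈ primeBlock L i → p ∈ primeBlock L j → False := by
    intro i j hij p hi hj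
    have h1 := (mem_primeBlock.1 hi).2.2
    have h2 := (mem_primeBlock.1 hj).2.1
    have h3 : L / 4 ^ j ≤ L / 4 ^ (i + 1) :=
      div_le_div_of_nonneg_left hL (by positivity) (pow_le_pow_right₀ (by norm_num) hij)
    linarith [Real.exp_le_exp.2 h3]
  rw [Finset.disjoint_left]
  intro p hi hj
  rcases lt_or_gt_of_ne hij with h | h
  · exact key i j h p hi hj
  · exact key j i h p hj hi

/-- A prime p ≤ e^L lies in block j, where j + 1 is the least index with exp(L/4^(j+1)) < p. -/
lemma biUnion_primeBlock {L : ℝ} (hL : 0 ≤ L) {R : ℕ} (hR : Real.exp (L / 4 ^ R) < 2) :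
    (Finset.range R).biUnion (primeBlock L) = ⌊Real.exp L⌋₊.primesLE := by
  classical
  ext p
  simp only [Finset.mem_biUnion, Finset.mem_range, mem_primeBlock, Nat.mem_primesLE,
    Nat.le_floor_iff (Real.exp_pos L).le]
  constructor
  · rintro ⟨i, -, hp, hle, -⟩
    refine ⟨hle.trans (Real.exp_le_exp.2 (div_le_self hL (one_le_pow₀ (by norm_num)))), hp⟩
  · rintro ⟨hle, hp⟩
    have h2 : (2 : ℝ) ≤ p := by exact_mod_cast hp.two_le
    have hex : ∃ i, Real.exp (L / 4 ^ i) < p := ⟨R, by linarith⟩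
    have hmin := fun m => Nat.find_min (m := m) hex
    have hspec := Nat.find_spec hex
    have hle' := Nat.find_min' hex (show Real.exp (L / 4 ^ R) < p by linarith)
    obtain ⟨j, hj⟩ : ∃ j, Nat.find hex = j + 1 := by
      refine Nat.exists_eq_succ_of_ne_zero fun h0 => ?_
      rw [h0, pow_zero, div_one] at hspec
      linarith
    rw [hj] at hspec hmin hle'
    exact ⟨j, by omega, hp, not_lt.1 (hmin j (by omega)), hspec⟩

lemma sum_primeBlock {L : ℝ} (hL : 0 ≤ L) {R : ℕ} (hR : Real.exp (L / 4 ^ R) < 2) (f : ℕ → ℝ) :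
    ∑ i ∈ Finset.range R, ∑ p ∈ primeBlock L i, f p = ∑ p ∈ ⌊Real.exp L⌋₊.primesLE, f p := by
  classical
  rw [← biUnion_primeBlock hL hR, Finset.sum_biUnion]
  exact fun i _ j _ hij => disjoint_primeBlock hL hij

/-! ### Lower bound for the mean square over all blocks. -/

lemma exp_sub_sq_le_one_add {u : ℝ} (hu : 0 ≤ u) : Real.exp (u - u ^ 2 / 2) ≤ 1 + u := by
  rw [← Real.le_log_iff_exp_le (by linarith)]
  refine le_trans ?_ (Real.le_log_one_add_of_nonneg hu)
  rw [le_div_iff₀ (by linarith)]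
  nlinarith [pow_nonneg hu 3]

namespace DirPoly

lemma one_le_pairing_linear_pow {P : Finset ℕ} (hP : ∀ p ∈ P, p.Prime) {c : ℝ} (hc : 0 ≤ c)
    (r : ℕ) : 1 ≤ pairing (linear P c ^ r) (linear P c ^ r) := by
  refine le_trans ?_ (sum_powerset_le_pairing hP hc r)
  refine le_trans (le_of_eq ?_) (Finset.single_le_sum (fun S _ =>
    mul_nonneg (sq_nonneg _) (Finset.prod_nonneg fun p _ => by positivity))
    (Finset.empty_mem_powerset P))
  simp

/-- `prod_mul_le_pairing` with κ = r/s slightly below k. Two losses occur, each at most ε in the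
exponent: rounding costs (2k/s)·12 = 24k/s, and the factor 1 - (κ²σ)²/r costs at most e^(-ε),
because 144k^4/r ≤ 288k³/s ≤ ε/2. The latter is what the constant 600 is chosen for. -/
lemma exp_le_pairing_linear_pow {P : Finset ℕ} (hP : ∀ p ∈ P, p.Prime) {k ε : ℝ} (hk : 1 < k)
    (hε1 : ε ≤ 1) {s : ℕ} (hs : 600 * k ^ 3 ≤ s * ε)
    (hσ : ∑ p ∈ P, 1 / (p : ℝ) ≤ 12) :
    Real.exp (k ^ 2 * ∑ p ∈ P, 1 / (p : ℝ) - k ^ 4 / 2 * ∑ p ∈ P, 1 / (p : ℝ) ^ 2 - 2 * ε) ≤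
      pairing (linear P (1 / (s : ℝ)) ^ ⌊k * s⌋₊) (linear P (1 / (s : ℝ)) ^ ⌊k * s⌋₊) := by
  set r := ⌊k * s⌋₊ with hr
  have hk3 : 1 ≤ k ^ 3 := one_le_pow₀ hk.le
  have hs0 : (0 : ℝ) ≤ s := Nat.cast_nonneg s
  have hε0 : 0 < ε := by
    by_contra! h
    nlinarith [mul_nonneg hs0 (neg_nonneg.2 h)]
  have hs600 : 600 * k ^ 3 ≤ s := hs.trans (mul_le_of_le_one_right hs0 hε1)
  have hspos : (0 : ℝ) < s := by nlinarith
  have hrle : (r : ℝ) ≤ k * s := Nat.floor_le (by positivity)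
  have hrlt : k * s < r + 1 := Nat.lt_floor_add_one _
  have hks : 2 ≤ k * s := by nlinarith
  have hrhalf : k * s / 2 ≤ r := by linarith
  have hrpos : (0 : ℝ) < r := by linarith
  have hr0 : 0 < r := by exact_mod_cast hrpos
  set σ := ∑ p ∈ P, 1 / (p : ℝ) with hσdef
  set τ := ∑ p ∈ P, 1 / (p : ℝ) ^ 2 with hτdef
  have hσ0 : 0 ≤ σ := Finset.sum_nonneg fun p _ => by positivity
  have hτ0 : 0 ≤ τ := Finset.sum_nonneg fun p _ => by positivity
  set κ : ℝ := r / s with hκ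
  have hκ0 : 0 ≤ κ := by positivity
  have hκk : κ ≤ k := (div_le_iff₀ hspos).2 hrle
  have hκk' : k - 1 / s ≤ κ := by
    rw [hκ, sub_le_iff_le_add, ← add_div, le_div_iff₀ hspos]; exact hrlt.le
  have hκ2 : k ^ 2 - 2 * k / s ≤ κ ^ 2 := by
    have h1 : (0 : ℝ) < 1 / s := by positivity
    have h2 : 1 / (s : ℝ) ≤ 1 := by rw [div_le_one hspos]; nlinarith
    have h3 : 2 * k / s = 2 * k * (1 / s) := by ring
    rw [h3]
    nlinarith
  have hκ4 : κ ^ 4 ≤ k ^ 4 := pow_le_pow_left₀ hκ0 hκk 4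
  refine le_trans ?_ (prod_mul_le_pairing hP hr0)
  have e1 : ∑ p ∈ P, κ ^ 2 / (p : ℝ) = κ ^ 2 * σ := by
    rw [hσdef, Finset.mul_sum]; exact Finset.sum_congr rfl fun p _ => by ring
  rw [e1]
  have h1 : Real.exp (k ^ 2 * σ - k ^ 4 / 2 * τ - ε) ≤ ∏ p ∈ P, (1 + κ ^ 2 / (p : ℝ)) := by
    have h2 : Real.exp (∑ p ∈ P, (κ ^ 2 / (p : ℝ) - (κ ^ 2 / (p : ℝ)) ^ 2 / 2)) ≤
        ∏ p ∈ P, (1 + κ ^ 2 / (p : ℝ)) := by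
      rw [Real.exp_sum]
      exact Finset.prod_le_prod (fun p _ => (Real.exp_pos _).le)
        fun p _ => exp_sub_sq_le_one_add (by positivity)
    refine le_trans (Real.exp_le_exp.2 ?_) h2
    have e2 : ∑ p ∈ P, (κ ^ 2 / (p : ℝ) - (κ ^ 2 / (p : ℝ)) ^ 2 / 2) =
        κ ^ 2 * σ - κ ^ 4 / 2 * τ := by
      have e3 : ∑ p ∈ P, (κ ^ 2 / (p : ℝ)) ^ 2 / 2 = κ ^ 4 / 2 * τ := by
        rw [hτdef, Finset.mul_sum]
        exact Finset.sum_congr rfl fun p _ => by ring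
      rw [Finset.sum_sub_distrib, e1, e3]
    rw [e2]
    have h3 : κ ^ 4 / 2 * τ ≤ k ^ 4 / 2 * τ := by gcongr
    have h4 : (k ^ 2 - 2 * k / s) * σ ≤ κ ^ 2 * σ := by gcongr
    have h5 : 2 * k / s * σ ≤ ε := by
      calc 2 * k / s * σ ≤ 2 * k / s * 12 := by gcongr
        _ = 24 * k / s := by ring
        _ ≤ ε := by
          rw [div_le_iff₀ hspos]
          have : k ≤ k ^ 3 := le_self_pow₀ hk.le (by norm_num)
          linarith
    nlinarith
  set x : ℝ := (κ ^ 2 * σ) ^ 2 / r with hx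
  have hx0 : 0 ≤ x := by positivity
  have hxle : x ≤ ε / 2 := by
    rw [hx, div_le_iff₀ hrpos]
    have h2 : κ ^ 2 * σ ≤ k ^ 2 * 12 := by gcongr
    calc (κ ^ 2 * σ) ^ 2 ≤ (k ^ 2 * 12) ^ 2 := by gcongr
      _ = 144 * k ^ 4 := by ring
      _ ≤ ε / 2 * (k * s / 2) := by nlinarith
      _ ≤ ε / 2 * r := by gcongr
  have h2 : Real.exp (-ε) ≤ 1 - x := by
    have hpos : 0 < 1 - x := by linarith
    rw [← Real.le_log_iff_exp_le hpos]
    have := Real.one_sub_inv_le_log_of_pos hpos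
    refine le_trans ?_ this
    have : (1 - x)⁻¹ ≤ 1 + ε := by
      rw [inv_le_iff_one_le_mul₀ hpos]
      nlinarith
    linarith
  have e3 : k ^ 2 * σ - k ^ 4 / 2 * τ - 2 * ε = (k ^ 2 * σ - k ^ 4 / 2 * τ - ε) + -ε := by ring
  rw [e3, Real.exp_add]
  exact mul_le_mul h1 h2 (Real.exp_pos _).le (h1.trans' (Real.exp_pos _).le)

/-- The mean square of the approximation to `ζ ^ k` is at least of order `L ^ (k ^ 2)`. -/
lemma exp_le_prod_pairing {k L : ℝ} (hk : 1 < k) (hL : 1 ≤ L) {R : ℕ}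
    (hR : Real.exp (L / 4 ^ R) < 2) {s₀ : ℕ} (hs₀ : 600 * k ^ 3 ≤ s₀) (s : ℕ → ℕ)
    (hs : ∀ i, s i = 2 ^ i * s₀) :
    Real.exp (k ^ 2 * (Real.log L - 1) - k ^ 4 / 2 - 4) ≤
      ∏ i ∈ Finset.range R, pairing (linear (primeBlock L i) (1 / (s i : ℝ)) ^ ⌊k * s i⌋₊)
        (linear (primeBlock L i) (1 / (s i : ℝ)) ^ ⌊k * s i⌋₊) := by
  have hL0 : 0 ≤ L := by linarith
  -- Block i is allotted ε = 2^(-i). As s_i = 2^i s₀, the requirement is 600k³ ≤ s₀ for every i, and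
  -- the losses 2ε add up to at most 4.
  have h1 : ∀ i ∈ Finset.range R, Real.exp (k ^ 2 * ∑ p ∈ primeBlock L i, 1 / (p : ℝ) -
      k ^ 4 / 2 * ∑ p ∈ primeBlock L i, 1 / (p : ℝ) ^ 2 - 2 * (1 / 2) ^ i) ≤
      pairing (linear (primeBlock L i) (1 / (s i : ℝ)) ^ ⌊k * s i⌋₊)
        (linear (primeBlock L i) (1 / (s i : ℝ)) ^ ⌊k * s i⌋₊) := by
    intro i _
    refine exp_le_pairing_linear_pow (fun p hp => (mem_primeBlock.1 hp).1) hk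
      (pow_le_one₀ (by norm_num) (by norm_num)) ?_ (sum_primeBlock_le i)
    rw [hs]
    push_cast
    have : (2 : ℝ) ^ i * s₀ * (1 / 2) ^ i = s₀ * (2 * (1 / 2)) ^ i := by rw [mul_pow]; ring
    rw [this]; norm_num; exact hs₀
  refine le_trans ?_ (Finset.prod_le_prod (fun i _ => (Real.exp_pos _).le) h1)
  rw [← Real.exp_sum, Real.exp_le_exp, Finset.sum_sub_distrib, Finset.sum_sub_distrib,
    ← Finset.mul_sum, ← Finset.mul_sum, ← Finset.mul_sum, sum_primeBlock hL0 hR fun p => 1 / (p : ℝ),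
    sum_primeBlock hL0 hR fun p => 1 / (p : ℝ) ^ 2]
  have hexp : (2 : ℝ) ≤ Real.exp L := by
    have := Real.add_one_le_exp L; linarith
  have hn : 2 ≤ ⌊Real.exp L⌋₊ := Nat.le_floor (by exact_mod_cast hexp)
  have h2 := log_log_le_sum_primesLE hn
  have h3 : L ≤ Real.log (⌊Real.exp L⌋₊ + 1 : ℕ) := by
    rw [Real.le_log_iff_exp_le (by positivity)]
    push_cast
    exact (Nat.lt_floor_add_one _).le
  have h4 := Real.log_le_log (by linarith) h3
  have h5 := sum_one_div_sq_le (s := ⌊Real.exp L⌋₊.primesLE) fun p hp =>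
    (Nat.mem_primesLE.1 hp).2.two_le
  have h6 : ∑ i ∈ Finset.range R, (1 / 2 : ℝ) ^ i ≤ 2 := by
    refine (Summable.sum_le_tsum _ (fun i _ => by positivity) summable_geometric_two).trans ?_
    rw [tsum_geometric_two]
  have h7 : k ^ 2 * (Real.log L - 1) ≤ k ^ 2 * ∑ p ∈ ⌊Real.exp L⌋₊.primesLE, 1 / (p : ℝ) := by
    gcongr; linarith
  have h8 : k ^ 4 / 2 * ∑ p ∈ ⌊Real.exp L⌋₊.primesLE, 1 / (p : ℝ) ^ 2 ≤ k ^ 4 / 2 * 1 := by gcongr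
  linarith

end DirPoly

/-! ### Upper bound for products of fractional powers. -/

/-- Bernoulli's inequality for y/l, together with l^θ ≤ l. With l the mean value of y, the affine
function has mean 1, so nothing is lost on average beyond the factor l. -/
lemma rpow_le_mul_affine {y l θ : ℝ} (hy : 0 ≤ y) (hl : 1 ≤ l) (hθ0 : 0 ≤ θ) (hθ1 : θ ≤ 1) :
    y ^ θ ≤ l * (θ / l * y + (1 - θ)) := by
  have hl0 : 0 < l := by linarith
  have h1 := rpow_one_add_le_one_add_mul_self (s := y / l - 1)
    (by linarith [div_nonneg hy hl0.le]) hθ0 hθ1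
  rw [add_sub_cancel] at h1
  have h2 : 1 + θ * (y / l - 1) = θ / l * y + (1 - θ) := by ring
  rw [h2] at h1
  have h3 : 0 ≤ θ / l * y + (1 - θ) :=
    add_nonneg (mul_nonneg (div_nonneg hθ0 hl0.le) hy) (by linarith)
  have h4 : l ^ θ ≤ l := by simpa using Real.rpow_le_rpow_of_exponent_le hl hθ1
  calc y ^ θ = l ^ θ * (y / l) ^ θ := by
        rw [← Real.mul_rpow hl0.le (div_nonneg hy hl0.le), mul_div_cancel₀ _ hl0.ne']
    _ ≤ l * (θ / l * y + (1 - θ)) := by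
        gcongr

lemma continuous_zeta_line :
    Continuous fun t : ℝ => riemannZeta (1 / 2 + (t : ℂ) * Complex.I) := by
  rw [continuous_iff_continuousAt]
  intro t
  have hne : (1 / 2 + (t : ℂ) * Complex.I) ≠ 1 := by
    intro h
    have := congrArg Complex.re h
    norm_num at this
  exact ContinuousAt.comp (f := fun t : ℝ => (1 / 2 + (t : ℂ) * Complex.I))
    (differentiableAt_riemannZeta hne).continuousAt (by fun_prop)

namespace DirPoly

/-- Mean values of products of fractional powers of Dirichlet polynomials over disjoint sets of
primes. -/
lemma integral_prod_rpow_le {ι : Type*} (I : Finset ι) (F : ι → DirPoly) (S : ι → Set ℕ)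
    (θ : ι → ℝ) (hS : ∀ i ∈ I, SupportedOn (S i) (F i)) (hd : (I : Set ι).PairwiseDisjoint S)
    (hF : ∀ i ∈ I, Nonneg (F i)) (hl : ∀ i ∈ I, 1 ≤ pairing (F i) (F i))
    (hθ0 : ∀ i ∈ I, 0 ≤ θ i) (hθ1 : ∀ i ∈ I, θ i ≤ 1) {N : ℕ} {K : ℝ}
    (hN : ∀ A ⊆ I, ∀ n ∈ (∏ i ∈ A, F i).coeff.support, n ≤ N)
    (hK : ∀ A ⊆ I, total (∏ i ∈ A, F i) ≤ K) {a b : ℝ} (hab : a ≤ b) :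
    ∫ t in a..b, ∏ i ∈ I, (‖eval t (F i)‖ ^ 2) ^ θ i ≤
      (∏ i ∈ I, pairing (F i) (F i)) * ((b - a) + 4 * N * K ^ 2) := by
  classical
  set l : ι → ℝ := fun i => pairing (F i) (F i) with hldef
  have hl0 : ∀ i ∈ I, 0 < l i := fun i hi => lt_of_lt_of_le one_pos (hl i hi)
  -- The law of a random subset containing each i independently with probability θ_i. Expanding the
  -- product of affine bounds gives an average over such subsets.
  let w : Finset ι → ℝ := fun A => (∏ i ∈ A, θ i) * ∏ i ∈ I \ A, (1 - θ i)
  have hw0 : ∀ A ∈ I.powerset, 0 ≤ w A := fun A hA => mul_nonneg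
    (Finset.prod_nonneg fun i hi => hθ0 i (Finset.mem_powerset.1 hA hi))
    (Finset.prod_nonneg fun i hi => sub_nonneg.2 (hθ1 i (Finset.sdiff_subset hi)))
  have hw1 : ∑ A ∈ I.powerset, w A = 1 := by
    rw [← Finset.prod_add]
    simp
  have hpt : ∀ t, ∏ i ∈ I, (‖eval t (F i)‖ ^ 2) ^ θ i ≤ (∏ i ∈ I, l i) *
      ∑ A ∈ I.powerset, w A / (∏ i ∈ A, l i) * ‖eval t (∏ i ∈ A, F i)‖ ^ 2 := by
    intro t
    have h1 : ∏ i ∈ I, (‖eval t (F i)‖ ^ 2) ^ θ i ≤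
        ∏ i ∈ I, (l i * (θ i / l i * ‖eval t (F i)‖ ^ 2 + (1 - θ i))) :=
      Finset.prod_le_prod (fun i _ => by positivity) fun i hi =>
        rpow_le_mul_affine (by positivity) (hl i hi) (hθ0 i hi) (hθ1 i hi)
    refine h1.trans (le_of_eq ?_)
    rw [Finset.prod_mul_distrib, Finset.prod_add]
    congr 1
    refine Finset.sum_congr rfl fun A _ => ?_
    rw [Finset.prod_mul_distrib, Finset.prod_div_distrib, map_prod, norm_prod, Finset.prod_pow]
    simp only [w]; ring
  have hcont : ∀ A : Finset ι, Continuous fun t => ‖eval t (∏ i ∈ A, F i)‖ ^ 2 := fun A =>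
    (continuous_eval _).norm.pow 2
  have hsq : ∀ A ∈ I.powerset, ∫ t in a..b, ‖eval t (∏ i ∈ A, F i)‖ ^ 2 ≤
      (∏ i ∈ A, l i) * (b - a) + 4 * N * K ^ 2 := by
    intro A hA
    have hA' := Finset.mem_powerset.1 hA
    set G := ∏ i ∈ A, F i with hG
    have hGn : Nonneg G := nonneg_prod _ _ fun i hi => hF i (hA' hi)
    have h1 := norm_integral_eval_mul_conj_sub_le hGn hGn (hN A hA') a b
    have e1 : ∫ t in a..b, eval t G * conj (eval t G) =
        ((∫ t in a..b, ‖eval t G‖ ^ 2 : ℝ) : ℂ) := by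
      rw [← intervalIntegral.integral_ofReal]
      refine intervalIntegral.integral_congr fun t _ => ?_
      simp [Complex.mul_conj, Complex.normSq_eq_norm_sq]
    have e2 : pairing G G = ∏ i ∈ A, l i :=
      pairing_prod_self A F S (fun i hi => hS i (hA' hi)) (hd.subset (by exact_mod_cast hA'))
    rw [e1, e2, ← Complex.ofReal_sub, Complex.norm_real] at h1
    have h2 := (le_abs_self _).trans h1
    have h3 : 4 * N * total G * total G ≤ 4 * N * K ^ 2 := by
      rw [mul_assoc, ← sq]
      have := hK A hA'
      have := total_nonneg hGn
      gcongr
    linarith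
  have hL0 : 0 ≤ ∏ i ∈ I, l i := Finset.prod_nonneg fun i hi => (hl0 i hi).le
  have hK0 : 0 ≤ 4 * (N : ℝ) * K ^ 2 := by positivity
  have hint : ∀ A : Finset ι, IntervalIntegrable
      (fun t => w A / (∏ i ∈ A, l i) * ‖eval t (∏ i ∈ A, F i)‖ ^ 2) MeasureTheory.volume a b :=
    fun A => (continuous_const.mul (hcont A)).intervalIntegrable _ _
  calc ∫ t in a..b, ∏ i ∈ I, (‖eval t (F i)‖ ^ 2) ^ θ i
      ≤ ∫ t in a..b, (∏ i ∈ I, l i) *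
      ∑ A ∈ I.powerset, w A / (∏ i ∈ A, l i) * ‖eval t (∏ i ∈ A, F i)‖ ^ 2 := by
        refine intervalIntegral.integral_mono_on hab ?_ ?_ fun t _ => hpt t
        · refine ContinuousOn.intervalIntegrable (continuousOn_finsetProd _ fun i hi => ?_)
          exact (((continuous_eval _).norm.pow 2).continuousOn).rpow_const
            fun x _ => Or.inr (hθ0 i hi)
        · exact (continuous_const.mul (continuous_finsetSum _ fun A _ =>
            continuous_const.mul (hcont A))).intervalIntegrable _ _
    _ = (∏ i ∈ I, l i) * ∑ A ∈ I.powerset, w A / (∏ i ∈ A, l i) *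
          ∫ t in a..b, ‖eval t (∏ i ∈ A, F i)‖ ^ 2 := by
        rw [intervalIntegral.integral_const_mul, intervalIntegral.integral_finsetSum
          fun A _ => hint A]
        simp only [intervalIntegral.integral_const_mul]
    _ ≤ (∏ i ∈ I, l i) * ∑ A ∈ I.powerset, w A * ((b - a) + 4 * N * K ^ 2) := by
        refine mul_le_mul_of_nonneg_left (Finset.sum_le_sum fun A hA => ?_) hL0
        have hA' := Finset.mem_powerset.1 hA
        -- Dividing by this product normalizes the main term and cannot enlarge the off-diagonal
        -- error.
        have h1 : 1 ≤ ∏ i ∈ A, l i := Finset.one_le_prod fun i hi => hl i (hA' hi)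
        have h2 : 0 < ∏ i ∈ A, l i := by linarith
        have h3 := hw0 A hA
        rw [div_mul_eq_mul_div, div_le_iff₀ h2, mul_assoc (w A)]
        refine mul_le_mul_of_nonneg_left ((hsq A hA).trans ?_) h3
        nlinarith
    _ = (∏ i ∈ I, l i) * ((b - a) + 4 * N * K ^ 2) := by
        rw [← Finset.sum_mul, hw1, one_mul]

/-! ### Lower bound for the twisted mean value of ζ. -/

/-- The partial sum of the Dirichlet series of `ζ` over `n < N`. -/
noncomputable def zetaSum (N : ℕ) : DirPoly := ∑ n ∈ Finset.range N, MonoidAlgebra.single n 1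

lemma nonneg_zetaSum (N : ℕ) : Nonneg (zetaSum N) :=
  nonneg_sum _ _ fun n _ => nonneg_single n zero_le_one

lemma coeff_zetaSum {N n : ℕ} (h : n < N) : (zetaSum N).coeff n = 1 := by
  rw [zetaSum, MonoidAlgebra.coeff_sum, Finsupp.finsetSum_apply, Finset.sum_eq_single n]
  · simp
  · intro m _ hm
    simp [hm]
  · intro hn; exact absurd (Finset.mem_range.2 h) hn

lemma eval_zetaSum (N : ℕ) (t : ℝ) : eval t (zetaSum N) =
    ∑ n ∈ Finset.range N, (n : ℂ) ^ (-(1 / 2 + (t : ℂ) * Complex.I)) := by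
  simp [zetaSum, eval, critChar]

lemma total_zetaSum_le (N : ℕ) : total (zetaSum N) ≤ 2 * √N := by
  have e : total (zetaSum N) = ∑ n ∈ Finset.range N, absChar n := by simp [zetaSum, total]
  rw [e]
  have key : ∀ n : ℕ, ∑ m ∈ Finset.range (n + 1), absChar m ≤ 2 * √n := by
    intro n
    induction n with
    | zero => simp [absChar_zero]
    | succ n ih =>
      rw [Finset.sum_range_succ]
      have h1 : absChar (n + 1) = 1 / √((n + 1 : ℕ) : ℝ) := by
        simp only [absChar, MonoidHom.coe_mk, OneHom.coe_mk]
        rw [Real.rpow_neg (by positivity), Real.sqrt_eq_rpow, one_div]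
        norm_num
      have hpos : 0 < √((n + 1 : ℕ) : ℝ) := by positivity
      have h2 : 2 * √(n : ℝ) + 1 / √((n + 1 : ℕ) : ℝ) ≤ 2 * √((n + 1 : ℕ) : ℝ) := by
        rw [← le_sub_iff_add_le', div_le_iff₀ hpos]
        have e1 := Real.sq_sqrt (show (0 : ℝ) ≤ ((n + 1 : ℕ) : ℝ) by positivity)
        have e2 := Real.sq_sqrt (show (0 : ℝ) ≤ (n : ℝ) by positivity)
        have e3 : (((n + 1 : ℕ) : ℝ)) = n + 1 := by push_cast; ring
        nlinarith [sq_nonneg (√((n + 1 : ℕ) : ℝ) - √(n : ℝ))]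
      rw [h1]; linarith
  rcases Nat.eq_zero_or_pos N with rfl | hN
  · simp
  · obtain ⟨n, rfl⟩ := Nat.exists_eq_succ_of_ne_zero hN.ne'
    refine (key n).trans ?_
    gcongr; simp

/-- Lower bound for the mean value of `ζ` against Dirichlet polynomials `B` and `W * B`. -/
lemma le_norm_integral_zeta_mul {W B : DirPoly} (hW : Nonneg W) (hB : Nonneg B)
    (hW1 : ∀ n, W.coeff n ≤ 1) {N M : ℕ} (hWM : ∀ n, W.coeff n ≠ 0 → n < M)
    (hN : ∀ n ∈ (W * B).coeff.support, n ≤ N) {a b δ : ℝ} (hab : a ≤ b)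
    (hδ : ∀ t ∈ Set.Icc a b, ‖riemannZeta (1 / 2 + (t : ℂ) * Complex.I) - eval t (zetaSum M)‖ ≤ δ) :
    (b - a) * pairing (W * B) (W * B) - 8 * N * √M * total B * total (W * B)
        - (b - a) * δ * total B * total (W * B) ≤
      ‖∫ t in a..b, riemannZeta (1 / 2 + (t : ℂ) * Complex.I) *
        (eval t B * conj (eval t (W * B)))‖ := by
  set C := W * B with hC
  have hCn : Nonneg C := hW.mul hB
  have hcB := continuous_eval B
  have hcC : Continuous fun t => conj (eval t C) := Complex.continuous_conj.comp (continuous_eval C)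
  -- Positivity enters here: on its support W has coefficients at most 1, which is the coefficient
  -- of the partial sum of ζ.
  have hZW : Nonneg (zetaSum M - W) := by
    rw [nonneg_sub_iff]
    intro n
    by_cases h : W.coeff n = 0
    · rw [h]; exact nonneg_zetaSum M n
    · rw [coeff_zetaSum (hWM n h)]; exact hW1 n
  have h1 : pairing C C ≤ pairing (zetaSum M * B) C := by
    refine pairing_mono_left hCn ?_
    rw [hC, ← sub_mul]
    exact hZW.mul hB
  have h2 := norm_integral_eval_mul_conj_sub_le ((nonneg_zetaSum M).mul hB) hCn hN a b
  set J := ∫ t in a..b, eval t (zetaSum M * B) * conj (eval t C) with hJ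
  have tB := total_nonneg hB
  have tC := total_nonneg hCn
  have h3 : (b - a) * pairing C C - 8 * N * √M * total B * total C ≤ ‖J‖ := by
    have h4 : ‖(((b - a) * pairing (zetaSum M * B) C : ℝ) : ℂ)‖ - ‖J‖ ≤
        4 * N * total (zetaSum M * B) * total C := by
      refine (norm_sub_norm_le _ _).trans ?_
      rwa [norm_sub_rev]
    have h5 : (b - a) * pairing C C ≤ ‖(((b - a) * pairing (zetaSum M * B) C : ℝ) : ℂ)‖ := by
      rw [Complex.norm_real]
      refine le_trans ?_ (le_abs_self _)
      have := sub_nonneg.2 hab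
      gcongr
    have h6 : 4 * N * total (zetaSum M * B) * total C ≤ 8 * N * √M * total B * total C := by
      rw [map_mul]
      calc 4 * N * (total (zetaSum M) * total B) * total C ≤
          4 * N * (2 * √M * total B) * total C := by
            have := total_zetaSum_le M
            gcongr
        _ = _ := by ring
    linarith
  have hI1 : IntervalIntegrable (fun t : ℝ => riemannZeta (1 / 2 + (t : ℂ) * Complex.I) *
      (eval t B * conj (eval t C))) MeasureTheory.volume a b :=
    (continuous_zeta_line.mul (hcB.mul hcC)).intervalIntegrable _ _
  have hI2 : IntervalIntegrable (fun t : ℝ => eval t (zetaSum M * B) * conj (eval t C))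
      MeasureTheory.volume a b := ((continuous_eval _).mul hcC).intervalIntegrable _ _
  have h7 : ‖(∫ t in a..b, riemannZeta (1 / 2 + (t : ℂ) * Complex.I) *
        (eval t B * conj (eval t C))) - J‖ ≤ (b - a) * δ * total B * total C := by
    rw [hJ, ← intervalIntegral.integral_sub hI1 hI2]
    have := intervalIntegral.norm_integral_le_of_norm_le_const (a := a) (b := b)
      (f := fun t : ℝ => riemannZeta (1 / 2 + (t : ℂ) * Complex.I) * (eval t B * conj (eval t C)) -
        eval t (zetaSum M * B) * conj (eval t C)) (C := δ * (total B * total C)) ?_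
    · refine this.trans (le_of_eq ?_)
      rw [abs_of_nonneg (sub_nonneg.2 hab)]; ring
    · intro t ht
      rw [Set.uIoc_of_le hab] at ht
      have e : riemannZeta (1 / 2 + (t : ℂ) * Complex.I) * (eval t B * conj (eval t C)) -
          eval t (zetaSum M * B) * conj (eval t C) =
          (riemannZeta (1 / 2 + (t : ℂ) * Complex.I) - eval t (zetaSum M)) *
            (eval t B * conj (eval t C)) := by
        rw [map_mul (eval t) (zetaSum M) B]; ring
      have h8 := hδ t ⟨ht.1.le, ht.2⟩
      rw [e, norm_mul, norm_mul, RCLike.norm_conj]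
      have := norm_eval_le_total hB t
      have := norm_eval_le_total hCn t
      have : 0 ≤ δ := (norm_nonneg _).trans h8
      gcongr
  have h9 := norm_sub_norm_le J (∫ t in a..b, riemannZeta (1 / 2 + (t : ℂ) * Complex.I) *
        (eval t B * conj (eval t C)))
  rw [norm_sub_rev] at h9
  linarith

end DirPoly

/-! ### Hölder's inequality and assembly of the two bounds. -/

lemma memLp_restrict_of_continuous {f : ℝ → ℂ} (hf : Continuous f) (a b : ℝ) (p : ENNReal) :
    MeasureTheory.MemLp f p (MeasureTheory.volume.restrict (Set.Ioc a b)) := by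
  obtain ⟨C, hC⟩ := (isCompact_Icc (a := a) (b := b)).exists_bound_of_continuousOn hf.continuousOn
  refine MeasureTheory.MemLp.of_bound hf.aestronglyMeasurable C ?_
  filter_upwards [MeasureTheory.ae_restrict_mem measurableSet_Ioc] with x hx
  exact hC x ⟨hx.1.le, hx.2⟩

/-- Hölder's inequality on an interval. -/
lemma norm_integral_mul_rpow_le {f g : ℝ → ℂ} (hf : Continuous f) (hg : Continuous g) {p : ℝ}
    (hp : 1 < p) {a b : ℝ} (hab : a ≤ b) :
    ‖∫ t in a..b, f t * g t‖ ^ p ≤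
      (∫ t in a..b, ‖f t‖ ^ p) * (∫ t in a..b, ‖g t‖ ^ (p / (p - 1))) ^ (p - 1) := by
  have hp0 : 0 < p := by linarith
  have hpq : p.HolderConjugate (p / (p - 1)) := Real.HolderConjugate.conjExponent hp
  have h1 := MeasureTheory.integral_mul_norm_le_Lp_mul_Lq hpq
    (memLp_restrict_of_continuous hf a b _) (memLp_restrict_of_continuous hg a b _)
  have h2 : ‖∫ t in a..b, f t * g t‖ ≤ ∫ t in Set.Ioc a b, ‖f t‖ * ‖g t‖ := by
    refine (intervalIntegral.norm_integral_le_integral_norm hab).trans (le_of_eq ?_)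
    rw [intervalIntegral.integral_of_le hab]
    simp only [norm_mul]
  rw [intervalIntegral.integral_of_le hab (f := fun t => ‖f t‖ ^ p),
    intervalIntegral.integral_of_le hab (f := fun t => ‖g t‖ ^ (p / (p - 1)))]
  set X := ∫ t in Set.Ioc a b, ‖f t‖ ^ p
  set Y := ∫ t in Set.Ioc a b, ‖g t‖ ^ (p / (p - 1))
  have hX : 0 ≤ X := MeasureTheory.integral_nonneg fun t => by positivity
  have hY : 0 ≤ Y := MeasureTheory.integral_nonneg fun t => by positivity
  calc ‖∫ t in a..b, f t * g t‖ ^ p ≤ (X ^ (1 / p) * Y ^ (1 / (p / (p - 1)))) ^ p := by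
        gcongr; exact h2.trans h1
    _ = X * Y ^ (p - 1) := by
        have h3 : p - 1 ≠ 0 := by linarith
        rw [Real.mul_rpow (by positivity) (by positivity), ← Real.rpow_mul hX, ← Real.rpow_mul hY]
        have e1 : 1 / p * p = 1 := by field_simp
        have e2 : 1 / (p / (p - 1)) * p = p - 1 := by field_simp
        rw [e1, e2, Real.rpow_one]

lemma mul_two_rpow_le_of_rpow_le {V m k : ℝ} (hV0 : 0 < V) (hm : 0 ≤ m)
    (h : (V / 2) ^ (2 * k) ≤ m * (2 * V) ^ (2 * k - 1)) : V * 2 ^ (-(4 * k)) ≤ m := by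
  have e4 : (V / 2) ^ (2 * k) = V * 2 ^ (-(4 * k)) * 2 * (2 * V) ^ (2 * k - 1) := by
    rw [Real.div_rpow hV0.le two_pos.le, Real.mul_rpow two_pos.le hV0.le,
      Real.rpow_sub_one hV0.ne', Real.rpow_sub_one two_ne_zero, Real.rpow_neg two_pos.le]
    have e5 : (2 : ℝ) ^ (4 * k) = 2 ^ (2 * k) * 2 ^ (2 * k) := by
      rw [← Real.rpow_add two_pos]; congr 1; ring
    rw [e5]
    have : (0 : ℝ) < 2 ^ (2 * k) := by positivity
    field_simp
  rw [e4] at h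
  have h8 := le_of_mul_le_mul_right h (by positivity)
  linarith

namespace DirPoly

/-- Lower bound for a moment of `ζ` over `[T, 2T]` from Dirichlet polynomials built from disjoint
blocks of primes. -/
lemma mul_prod_pairing_le_integral {k : ℝ} (hk : 1 < k) {ι : Type*} (I : Finset ι)
    (P : ι → Finset ℕ) (s r : ι → ℕ) (hP : ∀ i ∈ I, ∀ p ∈ P i, p.Prime)
    (hd : (I : Set ι).PairwiseDisjoint fun i => (P i : Set ℕ)) (hs : ∀ i ∈ I, 0 < s i)
    (hsr : ∀ i ∈ I, s i ≤ r i) (hrk : ∀ i ∈ I, (r i : ℝ) ≤ k * s i) (x : ι → ℝ)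
    (hx : ∀ i ∈ I, 1 ≤ x i) (hPx : ∀ i ∈ I, ∀ p ∈ P i, (p : ℝ) ≤ x i) {X : ℝ}
    (hX : ∏ i ∈ I, x i ^ r i ≤ X) {T δ : ℝ} {M : ℕ} (hT : 0 < T)
    (hδ : ∀ t ∈ Set.Icc T (2 * T),
      ‖riemannZeta (1 / 2 + (t : ℂ) * Complex.I) - eval t (zetaSum M)‖ ≤ δ)
    (hXM : X < M) (h1 : 8 * X ^ 3 * √M ≤ T / 4) (h2 : δ * X ^ 2 ≤ 1 / 4) (h3 : 4 * X ^ 3 ≤ T) :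
    T * (∏ i ∈ I, pairing (linear (P i) (1 / (s i : ℝ)) ^ r i)
        (linear (P i) (1 / (s i : ℝ)) ^ r i)) * 2 ^ (-(4 * k)) ≤
      ∫ t in T..(2 * T), ‖riemannZeta (1 / 2 + (t : ℂ) * Complex.I)‖ ^ (2 * k) := by
  classical
  set Y : ι → DirPoly := fun i => linear (P i) (1 / (s i : ℝ)) with hY
  have hYn : ∀ i, Nonneg (Y i) := fun i => nonneg_linear _ (by positivity)
  have hYS : ∀ i ∈ I, SupportedOn (P i) (Y i) := fun i hi => supportedOn_linear (hP i hi) _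
  have hYle : ∀ i ∈ I, SupportLe (x i) (Y i) := fun i hi =>
    supportLe_linear (hx i hi) (hPx i hi) _
  have hYt : ∀ i ∈ I, total (Y i) ≤ x i := fun i hi => by
    refine total_linear_le (hx i hi) (fun p hp => ⟨hP i hi p hp, hPx i hi p hp⟩) ?_
    have : (1 : ℝ) ≤ s i := by exact_mod_cast hs i hi
    rw [div_le_one (by linarith)]; exact this
  have hx0 : ∀ i ∈ I, 0 ≤ x i := fun i hi => zero_le_one.trans (hx i hi)
  -- One bound X serves for both the length and the sum of absolute values of every subproduct in
  -- use: W, B, C and the products over subsets of blocks.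
  have hsize : ∀ A ⊆ I, ∀ e : ι → ℕ, (∀ i ∈ A, e i ≤ r i) →
      total (∏ i ∈ A, Y i ^ e i) ≤ X ∧ SupportLe X (∏ i ∈ A, Y i ^ e i) := by
    intro A hA e he
    have hb : ∏ i ∈ A, x i ^ e i ≤ X := by
      refine le_trans ?_ ((Finset.prod_le_prod_of_subset_of_one_le hA
        (fun i hi => pow_nonneg (hx0 i (hA hi)) _)
        fun i hi _ => one_le_pow₀ (hx i hi)).trans hX)
      exact Finset.prod_le_prod (fun i hi => pow_nonneg (hx0 i (hA hi)) _)
        fun i hi => pow_le_pow_right₀ (hx i (hA hi)) (he i hi)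
    constructor
    · refine le_trans ?_ hb
      rw [map_prod]
      simp only [map_pow]
      exact Finset.prod_le_prod (fun i _ => pow_nonneg (total_nonneg (hYn i)) _)
        fun i hi => pow_le_pow_left₀ (total_nonneg (hYn i)) (hYt i (hA hi)) _
    · intro n hn
      exact (SupportLe.prod A _ (fun i => x i ^ e i) (fun i hi => pow_nonneg (hx0 i (hA hi)) _)
        (fun i hi => (hYle i (hA hi)).pow (hx0 i (hA hi)) _) n hn).trans hb
  -- W stands for ζ, B for ζ^(k-1), and their product C for ζ^k.
  set W := ∏ i ∈ I, Y i ^ s i with hW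
  set B := ∏ i ∈ I, Y i ^ (r i - s i) with hB
  set l : ι → ℝ := fun i => pairing (Y i ^ r i) (Y i ^ r i) with hl
  have hC : W * B = ∏ i ∈ I, Y i ^ r i := by
    rw [hW, hB, ← Finset.prod_mul_distrib]
    refine Finset.prod_congr rfl fun i hi => ?_
    rw [← pow_add]; congr 1; have := hsr i hi; omega
  have hYrS : ∀ i ∈ I, SupportedOn (P i) (Y i ^ r i) := fun i hi => (hYS i hi).pow _
  have hCl : pairing (W * B) (W * B) = ∏ i ∈ I, l i := by
    rw [hC]; exact pairing_prod_self I _ _ hYrS hd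
  have hl1 : ∀ i ∈ I, 1 ≤ l i := fun i hi =>
    one_le_pairing_linear_pow (hP i hi) (by positivity) _
  set Λ := ∏ i ∈ I, l i with hΛ
  have hΛ1 : 1 ≤ Λ := Finset.one_le_prod hl1
  have hX1 : 1 ≤ X := (Finset.one_le_prod fun i hi => one_le_pow₀ (hx i hi)).trans hX
  set N := ⌊X⌋₊ with hNdef
  have hNX : (N : ℝ) ≤ X := Nat.floor_le (by linarith)
  have hsupp : ∀ A ⊆ I, ∀ n ∈ (∏ i ∈ A, Y i ^ r i).coeff.support, n ≤ N := fun A hA n hn =>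
    Nat.le_floor ((hsize A hA r fun _ _ => le_rfl).2 n (Finsupp.mem_support_iff.1 hn))
  have hWn : Nonneg W := nonneg_prod _ _ fun i _ => (hYn i).pow _
  have hBn : Nonneg B := nonneg_prod _ _ fun i _ => (hYn i).pow _
  have hCn : Nonneg (W * B) := hWn.mul hBn
  have htB : total B ≤ X := (hsize I subset_rfl _ fun i _ => Nat.sub_le _ _).1
  have htC : total (W * B) ≤ X := by rw [hC]; exact (hsize I subset_rfl r fun _ _ => le_rfl).1
  have hδ0 : 0 ≤ δ := (norm_nonneg _).trans (hδ T ⟨le_rfl, by linarith⟩)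
  have hTT : T ≤ 2 * T := by linarith
  have lower := le_norm_integral_zeta_mul hWn hBn
    (coeff_prod_linear_pow_le_one I P s hP hd) (N := N) (M := M)
    (fun n hn => by
      have := (hsize I subset_rfl s hsr).2 n hn
      exact_mod_cast this.trans_lt hXM)
    (by rw [hC]; exact hsupp I subset_rfl) hTT hδ
  set S := ‖∫ t in T..(2 * T), riemannZeta (1 / 2 + (t : ℂ) * Complex.I) *
        (eval t B * conj (eval t (W * B)))‖ with hS
  have hlow : T * Λ / 2 ≤ S := by
    refine le_trans ?_ lower
    have tB := total_nonneg hBn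
    have tC := total_nonneg hCn
    have e1 : 8 * N * √M * total B * total (W * B) ≤ T / 4 := by
      calc 8 * N * √M * total B * total (W * B) ≤ 8 * X * √M * X * X := by gcongr
        _ = 8 * X ^ 3 * √M := by ring
        _ ≤ T / 4 := h1
    have e2 : (2 * T - T) * δ * total B * total (W * B) ≤ T / 4 := by
      calc (2 * T - T) * δ * total B * total (W * B) ≤ (2 * T - T) * δ * X * X := by
            have : 0 ≤ 2 * T - T := by linarith
            gcongr
        _ = T * (δ * X ^ 2) := by ring
        _ ≤ T * (1 / 4) := by gcongr
        _ = T / 4 := by ring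
    rw [hCl]
    nlinarith
  set q : ℝ := 2 * k / (2 * k - 1) with hq
  have hk1 : 0 < 2 * k - 1 := by linarith
  have hq0 : 0 < q := by positivity
  -- On block i, |B·C| contributes |Y_i|^(2r_i - s_i); θ_i expresses its q-th power through
  -- |Y_i^(r_i)|².
  let θ : ι → ℝ := fun i => ((r i - s i + r i : ℕ) : ℝ) * q / (2 * r i)
  have hr0 : ∀ i ∈ I, (0 : ℝ) < r i := fun i hi => by
    exact_mod_cast (hs i hi).trans_le (hsr i hi)
  have hpow : ∀ t, ‖eval t B * conj (eval t (W * B))‖ ^ q =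
      ∏ i ∈ I, (‖eval t (Y i ^ r i)‖ ^ 2) ^ θ i := by
    intro t
    rw [norm_mul, RCLike.norm_conj, hC, hB, map_prod, map_prod, norm_prod, norm_prod,
      ← Finset.prod_mul_distrib, ← Real.finsetProd_rpow _ _ fun i _ => by positivity]
    refine Finset.prod_congr rfl fun i hi => ?_
    rw [map_pow, map_pow, norm_pow, norm_pow, ← pow_add, ← pow_mul, ← Real.rpow_natCast_mul
      (norm_nonneg _), ← Real.rpow_natCast_mul (norm_nonneg _)]
    congr 1
    simp only [θ]
    have := (hr0 i hi).ne'
    push_cast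
    field_simp
  have upper : ∫ t in T..(2 * T), ‖eval t B * conj (eval t (W * B))‖ ^ q ≤ 2 * (T * Λ) := by
    simp only [hpow]
    refine (integral_prod_rpow_le I (fun i => Y i ^ r i) _ θ hYrS hd (fun i _ => (hYn i).pow _) hl1
      (fun i _ => by positivity) (fun i hi => ?_) hsupp
      (fun A hA => (hsize A hA r fun _ _ => le_rfl).1) hTT).trans ?_
    -- After clearing denominators, θ_i ≤ 1 is exactly r_i ≤ k s_i, which is why r_i is rounded
    -- down.
    · simp only [θ]
      have h5 := hr0 i hi
      have h6 := hrk i hi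
      rw [div_le_one (by positivity), hq, ← mul_div_assoc, div_le_iff₀ hk1, Nat.cast_add,
        Nat.cast_sub (hsr i hi)]
      nlinarith
    · have e3 : 4 * N * X ^ 2 ≤ T := by
        calc 4 * N * X ^ 2 ≤ 4 * X * X ^ 2 := by gcongr
          _ = 4 * X ^ 3 := by ring
          _ ≤ T := h3
      calc (∏ i ∈ I, pairing (Y i ^ r i) (Y i ^ r i)) * (2 * T - T + 4 * N * X ^ 2)
          ≤ Λ * (2 * T - T + T) := by
            show Λ * _ ≤ _
            gcongr
        _ = _ := by ring
  have hholder := norm_integral_mul_rpow_le continuous_zeta_line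
    ((continuous_eval B).mul (Complex.continuous_conj.comp (continuous_eval (W * B))))
    (show 1 < 2 * k by linarith) hTT
  rw [← hq] at hholder
  set V := T * Λ with hV
  have hV0 : 0 < V := mul_pos hT (by linarith)
  set m := ∫ t in T..(2 * T), ‖riemannZeta (1 / 2 + (t : ℂ) * Complex.I)‖ ^ (2 * k)
  have hm : 0 ≤ m := intervalIntegral.integral_nonneg hTT fun t _ => by positivity
  have h7 : (V / 2) ^ (2 * k) ≤ m * (2 * V) ^ (2 * k - 1) := by
    calc (V / 2) ^ (2 * k) ≤ S ^ (2 * k) := by gcongr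
      _ ≤ _ := hholder
      _ ≤ m * (2 * V) ^ (2 * k - 1) := by
        gcongr
        · exact intervalIntegral.integral_nonneg hTT fun t _ => by positivity
        · exact upper
  exact mul_two_rpow_le_of_rpow_le hV0 hm h7

end DirPoly

/-! ### Choice of parameters and conclusion. -/

/-- Block i contributes at most k s_i L/4^i = k s₀ L/2^i to the logarithm, a geometric series. -/
lemma prod_exp_pow_le {k L : ℝ} (hk : 0 < k) (hL : 0 ≤ L) {s₀ : ℕ} (s : ℕ → ℕ)
    (hs : ∀ i, s i = 2 ^ i * s₀) (R : ℕ) :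
    ∏ i ∈ Finset.range R, Real.exp (L / 4 ^ i) ^ ⌊k * s i⌋₊ ≤ Real.exp (2 * k * s₀ * L) := by
  have h1 : ∀ i ∈ Finset.range R, Real.exp (L / 4 ^ i) ^ ⌊k * s i⌋₊ ≤
      Real.exp (k * s₀ * L * (1 / 2) ^ i) := by
    intro i _
    rw [← Real.exp_nat_mul, Real.exp_le_exp]
    calc (⌊k * s i⌋₊ : ℝ) * (L / 4 ^ i) ≤ k * s i * (L / 4 ^ i) := by
          gcongr; exact Nat.floor_le (by positivity)
      _ = k * s₀ * L * (2 ^ i / 4 ^ i) := by rw [hs]; push_cast; ring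
      _ = k * s₀ * L * (1 / 2) ^ i := by rw [← div_pow]; norm_num
  refine (Finset.prod_le_prod (fun i _ => by positivity) h1).trans ?_
  rw [← Real.exp_sum, Real.exp_le_exp, ← Finset.mul_sum]
  have h6 : ∑ i ∈ Finset.range R, (1 / 2 : ℝ) ^ i ≤ 2 := by
    refine (Summable.sum_le_tsum _ (fun i _ => by positivity) summable_geometric_two).trans ?_
    rw [tsum_geometric_two]
  calc k * s₀ * L * ∑ i ∈ Finset.range R, (1 / 2 : ℝ) ^ i ≤ k * s₀ * L * 2 := by gcongr
    _ = _ := by ring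

/-- Collects all losses: log 2 for the half interval, 4k·log 2 from Hölder, log(50000k^4) from using
L in place of log T, 1 from Mertens, k^4/2 from ∑ 1/p², and 4 from the blocks. -/
lemma exponent_inequality {k : ℝ} (hk : 1 < k) :
    Real.log 2 * (1 + 4 * k) + k ^ 2 * (Real.log (50000 * k ^ 4) + 1) + k ^ 4 / 2 + 4 ≤
      30 * k ^ 4 := by
  have h1 : Real.log 50000 ≤ 11 := by
    rw [Real.log_le_iff_le_exp (by norm_num)]
    have h := Real.exp_one_gt_d9
    have : Real.exp 11 = Real.exp 1 ^ 11 := by rw [← Real.exp_nat_mul]; norm_num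
    rw [this]
    calc (50000 : ℝ) ≤ 2.7 ^ 11 := by norm_num
      _ ≤ Real.exp 1 ^ 11 := by gcongr; linarith
  have h2 : Real.log (50000 * k ^ 4) = Real.log 50000 + 4 * Real.log k := by
    rw [Real.log_mul (by norm_num) (by positivity), Real.log_pow]; norm_num
  have h3 : Real.log k ≤ k - 1 := Real.log_le_sub_one_of_pos (by linarith)
  have h4 : Real.log 2 ≤ 0.7 := by linarith [Real.log_two_lt_d9]
  have k2 : k ^ 2 ≤ k ^ 4 := pow_le_pow_right₀ hk.le (by norm_num)
  have k3 : k ^ 3 ≤ k ^ 4 := pow_le_pow_right₀ hk.le (by norm_num)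
  have k1 : k ≤ k ^ 4 := le_self_pow₀ hk.le (by norm_num)
  have k0 : 1 ≤ k ^ 4 := one_le_pow₀ hk.le
  have h5 : k ^ 2 * (Real.log (50000 * k ^ 4) + 1) ≤ 8 * k ^ 2 + 4 * k ^ 3 := by
    rw [h2]
    calc k ^ 2 * (Real.log 50000 + 4 * Real.log k + 1) ≤ k ^ 2 * (11 + 4 * (k - 1) + 1) := by gcongr
      _ = _ := by ring
  have h6 : Real.log 2 * (1 + 4 * k) ≤ 0.7 * (1 + 4 * k) := by gcongr
  linarith

/-- Continuous lower bounds for moments of the Riemann zeta function: Hölder's inequality is applied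
to `ζ` and Dirichlet polynomials approximating `ζ ^ (k - 1)` and the conjugate of `ζ ^ k`, built from
blocks of primes in the intervals `(exp (L / 4 ^ (i + 1)), exp (L / 4 ^ i)]`. -/
theorem theorem1 (k : ℝ) (hk : 1 < k) :
    ∃ T₀ : ℝ, ∀ T : ℝ, T₀ ≤ T →
      Real.exp (-30 * k ^ 4) * T * Real.log T ^ (k ^ 2) ≤ zetaMoment k T := by
  -- The first entry makes u = U^(1/40) at least 128, which absorbs the numerical constants; the
  -- second makes L ≥ 1.
  refine ⟨max (128 ^ 40) (Real.exp (50000 * k ^ 4)), fun U hU => ?_⟩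
  have hU1 : (128 : ℝ) ^ 40 ≤ U := (le_max_left _ _).trans hU
  have hU2 : Real.exp (50000 * k ^ 4) ≤ U := (le_max_right _ _).trans hU
  have hU0 : 0 < U := lt_of_lt_of_le (by positivity) hU1
  set u : ℝ := U ^ (1 / 40 : ℝ) with hu
  have huU : u ^ 40 = U := by
    rw [hu, ← Real.rpow_natCast, ← Real.rpow_mul hU0.le]; norm_num
  have hu128 : 128 ≤ u := by
    by_contra! h
    have : u ^ 40 < 128 ^ 40 := pow_lt_pow_left₀ h (by positivity) (by norm_num)
    linarith
  have hu0 : 0 < u := by linarith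
  have hlogU : 50000 * k ^ 4 ≤ Real.log U := (Real.le_log_iff_exp_le hU0).2 hU2
  have hk4 : 1 ≤ k ^ 4 := one_le_pow₀ hk.le
  have hk3 : 1 ≤ k ^ 3 := one_le_pow₀ hk.le
  -- Since 2k s₀ ≤ 1202k^4 and 1202/50000 ≤ 1/40, all polynomials have length at most u.
  set L : ℝ := Real.log U / (50000 * k ^ 4) with hL
  have hL1 : 1 ≤ L := (one_le_div (by positivity)).2 hlogU
  obtain ⟨R, hR⟩ : ∃ R : ℕ, Real.exp (L / 4 ^ R) < 2 := by
    have h1 : Tendsto (fun R : ℕ => L / (4 : ℝ) ^ R) atTop (𝓝 0) :=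
      tendsto_const_nhds.div_atTop (tendsto_pow_atTop_atTop_of_one_lt (by norm_num))
    have h2 := (Real.continuous_exp.tendsto 0).comp h1
    rw [Real.exp_zero] at h2
    exact (h2.eventually (gt_mem_nhds one_lt_two)).exists
  set s₀ : ℕ := ⌈600 * k ^ 3⌉₊ with hs₀
  have hs₀1 : 600 * k ^ 3 ≤ s₀ := Nat.le_ceil _
  have hs₀2 : (s₀ : ℝ) ≤ 601 * k ^ 3 := by
    have := Nat.ceil_lt_add_one (show 0 ≤ 600 * k ^ 3 by positivity)
    linarith
  have hs₀pos : 0 < s₀ := Nat.ceil_pos.2 (by positivity)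
  let s : ℕ → ℕ := fun i => 2 ^ i * s₀
  have hX : Real.exp (2 * k * s₀ * L) ≤ u := by
    rw [← Real.le_log_iff_exp_le hu0, hu, Real.log_rpow hU0]
    calc 2 * k * s₀ * L ≤ 2 * k * (601 * k ^ 3) * L := by gcongr
      _ = 1202 / 50000 * Real.log U := by rw [hL]; field_simp; ring
      _ ≤ 1 / 40 * Real.log U := by
        exact mul_le_mul_of_nonneg_right (by norm_num) (le_trans (by positivity) hlogU)
  -- M is about U^(3/2), which balances the errors √M/t and t²/M^(3/2) for t of order U: both have
  -- order u^(-10).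
  set M : ℕ := ⌈u ^ 60⌉₊ with hM
  have hM1 : u ^ 60 ≤ M := Nat.le_ceil _
  have hu60 : 1 ≤ u ^ 60 := one_le_pow₀ (by linarith)
  have hM2 : (M : ℝ) ≤ 2 * u ^ 60 := by
    have := Nat.ceil_lt_add_one (show 0 ≤ u ^ 60 by positivity)
    linarith
  have hMpos : 0 < M := Nat.ceil_pos.2 (by positivity)
  have hsM1 : u ^ 30 ≤ √M := by
    apply Real.le_sqrt_of_sq_le
    calc (u ^ 30) ^ 2 = u ^ 60 := by ring
      _ ≤ (M : ℝ) := hM1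
  have hsM2 : √M ≤ 2 * u ^ 30 := by
    rw [Real.sqrt_le_left (by positivity)]
    calc (M : ℝ) ≤ 2 * u ^ 60 := hM2
      _ ≤ 4 * u ^ 60 := by linarith
      _ = (2 * u ^ 30) ^ 2 := by ring
  have hδ : ∀ t ∈ Set.Icc (U / 2) (2 * (U / 2)),
      ‖riemannZeta (1 / 2 + (t : ℂ) * Complex.I) - DirPoly.eval t (DirPoly.zetaSum M)‖ ≤
        11 / u ^ 10 := by
    intro t ht
    have ht1 : u ^ 40 / 2 ≤ t := by rw [huU]; exact ht.1
    have ht2 : t ≤ u ^ 40 := by rw [huU]; linarith [ht.2]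
    have hu40 : (2 : ℝ) ≤ u ^ 40 := by
      calc (2 : ℝ) ≤ u := by linarith
        _ ≤ u ^ 40 := le_self_pow₀ (by linarith) (by norm_num)
    rw [DirPoly.eval_zetaSum]
    refine (norm_riemannZeta_sub_sum_le hMpos (by linarith)).trans ?_
    rw [Real.rpow_neg (by positivity), ← Real.sqrt_eq_rpow]
    have f1 : (√(M : ℝ))⁻¹ ≤ 1 / u ^ 30 := by
      rw [← one_div]; exact one_div_le_one_div_of_le (by positivity) hsM1
    have f2 : √(M : ℝ) / t ≤ 4 / u ^ 10 := by
      calc √(M : ℝ) / t ≤ 2 * u ^ 30 / (u ^ 40 / 2) := by gcongr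
        _ = 4 / u ^ 10 := by field_simp; norm_num
    have f3 : 6 * t ^ 2 * (√(M : ℝ))⁻¹ / M ≤ 6 / u ^ 10 := by
      have ht0 : 0 ≤ t := by linarith
      calc 6 * t ^ 2 * (√(M : ℝ))⁻¹ / M ≤ 6 * (u ^ 40) ^ 2 * (1 / u ^ 30) / u ^ 60 := by gcongr
        _ = 6 / u ^ 10 := by field_simp
    have f4 : 1 / u ^ 30 ≤ 1 / u ^ 10 :=
      one_div_le_one_div_of_le (by positivity) (pow_le_pow_right₀ (by linarith) (by norm_num))
    have e : (11 : ℝ) / u ^ 10 = 1 / u ^ 10 + 4 / u ^ 10 + 6 / u ^ 10 := by ring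
    rw [e]
    linarith
  have hu7 : 128 * 128 ≤ u ^ 7 := by
    calc (128 * 128 : ℝ) ≤ u * u := by gcongr
      _ = u ^ 2 := by ring
      _ ≤ u ^ 7 := pow_le_pow_right₀ (by linarith) (by norm_num)
  have hmain := DirPoly.mul_prod_pairing_le_integral hk (Finset.range R) (primeBlock L) s
    (fun i => ⌊k * s i⌋₊) (fun i _ p hp => (mem_primeBlock.1 hp).1)
    (fun i _ j _ hij => Finset.disjoint_coe.2 (disjoint_primeBlock (by linarith) hij))
    (fun i _ => by positivity)
    (fun i _ => Nat.le_floor (le_mul_of_one_le_left (Nat.cast_nonneg _) hk.le))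
    (fun i _ => Nat.floor_le (by positivity)) (fun i => Real.exp (L / 4 ^ i))
    (fun i _ => Real.one_le_exp (by positivity)) (fun i _ p hp => (mem_primeBlock.1 hp).2.1)
    ((prod_exp_pow_le (by linarith) (by linarith) s (fun i => rfl) R).trans hX)
    (T := U / 2) (by positivity) hδ
    (by
      calc u = u ^ 1 := (pow_one u).symm
        _ < u ^ 60 := pow_lt_pow_right₀ (by linarith) (by norm_num)
        _ ≤ M := hM1)
    (by
      calc 8 * u ^ 3 * √M ≤ 8 * u ^ 3 * (2 * u ^ 30) := by gcongr
        _ = 16 * u ^ 33 := by ring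
        _ ≤ u ^ 7 / 8 * u ^ 33 := by gcongr; linarith
        _ = u ^ 40 / 2 / 4 := by ring
        _ = U / 2 / 4 := by rw [huU])
    (by
      calc 11 / u ^ 10 * u ^ 2 = 11 / u ^ 8 := by field_simp
        _ ≤ 11 / u ^ 7 := by gcongr <;> linarith
        _ ≤ 11 / (128 * 128) := by gcongr
        _ ≤ 1 / 4 := by norm_num)
    (by
      calc 4 * u ^ 3 = 4 * (u ^ 3 * 1) := by ring
        _ ≤ 4 * (u ^ 3 * u ^ 30) := by gcongr; exact one_le_pow₀ (by linarith)
        _ = 4 * u ^ 33 := by ring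
        _ ≤ u ^ 7 / 2 * u ^ 33 := by gcongr; linarith
        _ = u ^ 40 / 2 := by ring
        _ = U / 2 := by rw [huU])
  have hprod := DirPoly.exp_le_prod_pairing hk hL1 hR hs₀1 s (fun i => rfl)
  have hint : ∀ a b : ℝ, IntervalIntegrable
      (fun t : ℝ => ‖riemannZeta (1 / 2 + (t : ℂ) * Complex.I)‖ ^ (2 * k))
      MeasureTheory.volume a b := fun a b =>
    (continuous_zeta_line.norm.rpow_const fun t => Or.inr (by linarith)).intervalIntegrable _ _
  have hsub : ∫ t in (U / 2)..(2 * (U / 2)), ‖riemannZeta (1 / 2 + (t : ℂ) * Complex.I)‖ ^ (2 * k) ≤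
      zetaMoment k U := by
    rw [zetaMoment, ← intervalIntegral.integral_add_adjacent_intervals (hint 0 (U / 2)) (hint _ U),
      show 2 * (U / 2) = U by ring]
    have : 0 ≤ ∫ t in (0 : ℝ)..(U / 2), ‖riemannZeta (1 / 2 + (t : ℂ) * Complex.I)‖ ^ (2 * k) :=
      intervalIntegral.integral_nonneg (by positivity) fun t _ => by positivity
    linarith
  refine le_trans ?_ (hmain.trans hsub)
  have hlogU0 : 0 < Real.log U := lt_of_lt_of_le (by positivity) hlogU
  have hlogL : Real.log L = Real.log (Real.log U) - Real.log (50000 * k ^ 4) :=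
    Real.log_div hlogU0.ne' (by positivity)
  calc Real.exp (-30 * k ^ 4) * U * Real.log U ^ (k ^ 2)
      = U * Real.exp (-30 * k ^ 4 + k ^ 2 * Real.log (Real.log U)) := by
        rw [Real.rpow_def_of_pos hlogU0, Real.exp_add, mul_comm (k ^ 2)]; ring
    _ ≤ U * Real.exp (-Real.log 2 + (k ^ 2 * (Real.log L - 1) - k ^ 4 / 2 - 4)
          + Real.log 2 * (-(4 * k))) := by
        refine mul_le_mul_of_nonneg_left (Real.exp_le_exp.2 ?_) hU0.le
        rw [hlogL]
        have := exponent_inequality hk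
        linarith
    _ = U / 2 * Real.exp (k ^ 2 * (Real.log L - 1) - k ^ 4 / 2 - 4) * 2 ^ (-(4 * k)) := by
        rw [Real.exp_add, Real.exp_add, Real.exp_neg, Real.exp_log two_pos,
          Real.rpow_def_of_pos two_pos]
        ring
    _ ≤ _ := by gcongr
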